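/- Let $G=(V,E)$ be a finite simple graph; edges are similar pairs and non-edges (of distinct vertices) are dissimilar pairs. A clustering is a partition of $V$ into non-empty clusters; its cost is the number of edges whose endpoints lie in different clusters plus the number of non-edges whose endpoints lie in the same cluster, and $\mathrm{OPT}(G)$ is the minimum cost of a clustering. The randomized algorithm ModifiedPivot, with parameters $\epsilon=0.007$ and $\delta=0.179$, keeps a set $R$ of remaining vertices (initially $R=V$) and a set $A$ (initially $A=\emptyset$). For a vertex $x$ let $N(x)$ be the set of neighbors of $x$ that lie in $R$. While $R\neq\emptyset$, it does the following. 1. It picks $v\in R$ uniformly at random and lets $C_v=\{v\}\cup N(v)$. 2. It lets $D_v=\{u\in N(v) : |N(u)\cap C_v|\le \delta|C_v|-1\}$ and lets $D'_v$ be a uniformly random subset of $D_v$ with $\min\{|D_v|,\lfloor\delta|C_v|\rfloor\}$ elements. 3. It lets $A_v=\{w\in R\setminus C_v : w\notin A,\ |N(w)\,\Delta\, C_v|\le\epsilon|C_v|-1\}$ and lets $A'_v$ be a uniformly random subset of $A_v$ with $\min\{|A_v|,\lfloor\delta|C_v|\rfloor\}$ elements. 4. It makes each vertex of $(D'_v\setminus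 A)\cup(A_v\setminus A'_v)$ a singleton cluster, and puts all vertices of $(C_v\cup A'_v)\setminus(D'_v\cup A)$ into one cluster (if there are any). 5. It replaces $A$ by $A\cup A_v$ and $R$ by $R\setminus C_v$. **Theorem.** For every finite simple graph $G$, the output $\mathcal C$ of ModifiedPivot is always a clustering of $V$, and $$\mathbb E[\mathrm{cost}(\mathcal C)]\le 2.997\cdot \mathrm{OPT}(G).$$ -/

import Mathlib

namespace CorrelationClustering

noncomputable section

section Clusterings

variable {V : Type*} [Fintype V] [DecidableEq V]

/-- A family of sets of vertices is a clustering if its members are non-empty and every vertex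
lies in exactly one of them. -/
def IsClustering (P : Finset (Finset V)) : Prop :=
  ∅ ∉ P ∧ ∀ v : V, ∃! S : Finset V, S ∈ P ∧ v ∈ S

/-- Both endpoints of the pair `e` lie in a common cluster of `P`. -/
def Together (P : Finset (Finset V)) (e : Sym2 V) : Prop :=
  ∃ S ∈ P, ∀ x ∈ e, x ∈ S

instance (P : Finset (Finset V)) : DecidablePred (Together P) := fun e => by
  unfold Together; infer_instance

/-- The correlation clustering cost: the number of edges (similar pairs) that go across clusters
plus the number of non-edges (dissimilar pairs of distinct vertices) inside clusters. -/
def cost (G : SimpleGraph V) [DecidableRel G.Adj] (P : Finset (Finset V)) : ℕ :=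
  (G.edgeFinset.filter fun e => ¬ Together P e).card +
    (Gᶜ.edgeFinset.filter fun e => Together P e).card

/-- The minimum cost of a clustering of the vertices of `G`. -/
def opt (G : SimpleGraph V) [DecidableRel G.Adj] : ℕ :=
  sInf {c : ℕ | ∃ P : Finset (Finset V), IsClustering P ∧ cost G P = c}

/-- The expected cost of a random clustering. -/
def expectedCost (G : SimpleGraph V) [DecidableRel G.Adj] (p : PMF (Finset (Finset V))) : ℝ :=
  ∑ P : Finset (Finset V), (p P).toReal * (cost G P : ℝ)

end Clusterings

section Algorithm

variable {V : Type*} [DecidableEq V]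

/-- A uniformly random subset of `S` with `min |S| m` elements. -/
def uniformSubset (S : Finset V) (m : ℕ) : PMF (Finset V) :=
  PMF.uniformOfFinset (S.powersetCard (min S.card m))
    (Finset.powersetCard_nonempty.mpr (min_le_left _ _))

/-- A uniformly random element of the non-empty finite set `R`. -/
def uniformVertex (R : Finset V) (hR : R.Nonempty) : PMF {v : V // v ∈ R} :=
  PMF.uniformOfFinset R.attach (Finset.attach_nonempty_iff.mpr hR)

variable (G : SimpleGraph V) [DecidableRel G.Adj]

/-- `N(v)`: the neighbours of `v` among the remaining vertices `R`. -/
def nbr (R : Finset V) (v : V) : Finset V :=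
  R.filter fun u => G.Adj v u

/-- `C_v = {v} ∪ N(v)`. -/
def setC (R : Finset V) (v : V) : Finset V :=
  insert v (nbr G R v)

/-- `D_v`: the neighbours `u` of `v` with `|N(u) ∩ C_v| ≤ δ |C_v| - 1`. -/
def setD (δ : ℝ) (R : Finset V) (v : V) : Finset V :=
  (nbr G R v).filter fun u =>
    ((nbr G R u ∩ setC G R v).card : ℝ) ≤ δ * ((setC G R v).card : ℝ) - 1

/-- `A_v`: the remaining vertices `w` outside `C_v` and outside `A` with
`|N(w) Δ C_v| ≤ ε |C_v| - 1`. -/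
def setA (ε : ℝ) (R A : Finset V) (v : V) : Finset V :=
  (R \ setC G R v).filter fun w =>
    w ∉ A ∧ ((symmDiff (nbr G R w) (setC G R v)).card : ℝ) ≤ ε * ((setC G R v).card : ℝ) - 1

/-- The sample size `⌊δ |C_v|⌋`. -/
def sampleSize (δ : ℝ) (R : Finset V) (v : V) : ℕ :=
  ⌊δ * ((setC G R v).card : ℝ)⌋₊

/-- The clusters formed in the iteration with pivot `v` and samples `D' ⊆ D_v`, `A' ⊆ A_v`:
a singleton for each vertex of `(D' \ A) ∪ (A_v \ A')`, and the single cluster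
`(C_v ∪ A') \ (D' ∪ A)` (if it is non-empty). -/
def newClusters (ε : ℝ) (R A : Finset V) (v : V) (D' A' : Finset V) : Finset (Finset V) :=
  (insert ((setC G R v ∪ A') \ (D' ∪ A))
    (((D' \ A) ∪ (setA G ε R A v \ A')).image fun x => {x})).erase ∅

theorem card_sdiff_setC_lt (R : Finset V) (v : V) (hv : v ∈ R) :
    (R \ setC G R v).card < R.card := by
  refine Finset.card_lt_card (Finset.ssubset_iff_subset_ne.mpr ⟨Finset.sdiff_subset, fun h => ?_⟩)
  have h1 : v ∈ R \ setC G R v := h.symm ▸ hv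
  exact (Finset.mem_sdiff.mp h1).2 (Finset.mem_insert_self _ _)

/-- The while loop of the algorithm, started with remaining vertices `R` and with the set `A`;
the result is the law of the family of clusters formed from that point on. -/
def modifiedPivotLoop (ε δ : ℝ) (R A : Finset V) : PMF (Finset (Finset V)) :=
  if hR : R.Nonempty then
    (uniformVertex R hR).bind fun v =>
      (uniformSubset (setD G δ R v.1) (sampleSize G δ R v.1)).bind fun D' =>
        (uniformSubset (setA G ε R A v.1) (sampleSize G δ R v.1)).bind fun A' =>
          (modifiedPivotLoop ε δ (R \ setC G R v.1) (A ∪ setA G ε R A v.1)).map fun P =>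
            newClusters G ε R A v.1 D' A' ∪ P
  else
    PMF.pure ∅
termination_by R.card
decreasing_by exact card_sdiff_setC_lt G R v.1 v.2

/-- The law of the output of the randomized algorithm on the whole graph `G`. -/
def modifiedPivot [Fintype V] (ε δ : ℝ) : PMF (Finset (Finset V)) :=
  modifiedPivotLoop G ε δ Finset.univ ∅

end Algorithm

end

end CorrelationClustering

/-! The proof refines the bad-triangle charging that gives factor 3 for the plain pivot algorithm. A
bad triangle has two edges and one non-edge. With the pivot `v` fixed, every mistake decided in the
iteration is charged to triangles `v x y`, and only bad ones receive a charge. The mistakes of plain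
pivot cost 1 each (`mainCharge`). The mistakes caused by removing `D'` from the pivot's cluster, or
by handling the candidates `F = A_v` and the chosen `F' = A'_v`, are few by definition of `D_v` and
`A_v`; they are spread thinly over many bad triangles (`sum_extraCost_le`). In return, triangles
with a removed or a joining vertex mostly lose their unit charge.

Fix an optimal clustering `P`. It errs on every bad triangle, so the total charge, summed over
pivots, is at most the sum over the errors `(a, b)` of `P` of the charge on all triangles through
`a` and `b`. The core estimate `sum_triangleCharge_le` bounds the latter by `2.997 |C_a ∪ C_b|`.
Since `C_a ∪ C_b` is exactly the set of pivots after which `a` and `b` no longer both remain, the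
expected cost of an iteration is at most 2.997 times the expected drop of the cost of `P` on `R`.
Induction on `|R|` sums these drops. The potential lives on all of `R`, including already clustered
vertices, because these can still be pivots.

The core estimate beats 3 for the following reasons. For an edge `ab`, bad triangles come from the
symmetric difference of `C_a` and `C_b`. Either their intersection is large enough to leave slack in
the union, or one endpoint is often removed from the other's cluster. For a non-edge, bad triangles
come from the common neighbours. Either these are clearly fewer than the union, or one endpoint is a
candidate for the other's cluster. In the second case it joins with fair probability, unless there
are so many candidates that most common neighbours `x` have a `C_x` much larger than `C_a`; then `a`
is often removed from the cluster of `x`. -/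

namespace CorrelationClustering

open Finset

/-! ### Expectations under finite laws. -/

noncomputable section Expectation

/-- The expectation of `g` under a law on a finite type. -/
def expect {α : Type*} [Fintype α] (p : PMF α) (g : α → ℝ) : ℝ := ∑ a, (p a).toReal * g a

variable {α β : Type*} [Fintype α] [Fintype β]

theorem sum_toReal_eq_one (p : PMF α) : ∑ a, (p a).toReal = 1 := by
  rw [← ENNReal.toReal_sum fun a _ => p.apply_ne_top a, ← tsum_fintype (L := .unconditional α),
    p.tsum_coe, ENNReal.toReal_one]

theorem expect_const (p : PMF α) (c : ℝ) : expect p (fun _ => c) = c := by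
  rw [expect, ← Finset.sum_mul, sum_toReal_eq_one, one_mul]

theorem expect_add (p : PMF α) (f g : α → ℝ) :
    expect p (fun a => f a + g a) = expect p f + expect p g := by
  simp only [expect, mul_add, Finset.sum_add_distrib]

theorem expect_sub (p : PMF α) (f g : α → ℝ) :
    expect p (fun a => f a - g a) = expect p f - expect p g := by
  simp only [expect, mul_sub, Finset.sum_sub_distrib]

theorem expect_mul_const (p : PMF α) (f : α → ℝ) (c : ℝ) :
    expect p (fun a => f a * c) = expect p f * c := by
  simp only [expect, ← mul_assoc, Finset.sum_mul]

theorem expect_sum {ι : Type*} (s : Finset ι) (p : PMF α) (f : ι → α → ℝ) :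
    expect p (fun a => ∑ i ∈ s, f i a) = ∑ i ∈ s, expect p (f i) := by
  simp only [expect, Finset.mul_sum]
  exact Finset.sum_comm

theorem expect_mono (p : PMF α) {f g : α → ℝ} (h : ∀ a ∈ p.support, f a ≤ g a) :
    expect p f ≤ expect p g := by
  refine Finset.sum_le_sum fun a _ => ?_
  by_cases ha : a ∈ p.support
  · exact mul_le_mul_of_nonneg_left (h a ha) ENNReal.toReal_nonneg
  · rw [PMF.mem_support_iff, not_not] at ha
    simp [ha]

theorem expect_congr (p : PMF α) {f g : α → ℝ} (h : ∀ a ∈ p.support, f a = g a) :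
    expect p f = expect p g :=
  le_antisymm (expect_mono p fun a ha => (h a ha).le) (expect_mono p fun a ha => (h a ha).ge)

theorem expect_nonneg (p : PMF α) {f : α → ℝ} (h : ∀ a ∈ p.support, 0 ≤ f a) :
    0 ≤ expect p f := by
  simpa [expect_const] using expect_mono p (f := fun _ => 0) h

theorem expect_le_const (p : PMF α) {f : α → ℝ} {c : ℝ} (h : ∀ a ∈ p.support, f a ≤ c) :
    expect p f ≤ c := by
  simpa [expect_const] using expect_mono p (g := fun _ => c) h

theorem expect_bind (p : PMF α) (f : α → PMF β) (g : β → ℝ) :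
    expect (p.bind f) g = expect p fun a => expect (f a) g := by
  simp only [expect, PMF.bind_apply, tsum_fintype]
  have h : ∀ b, (∑ a, p a * f a b).toReal = ∑ a, (p a).toReal * (f a b).toReal := fun b => by
    rw [ENNReal.toReal_sum fun a _ => ENNReal.mul_ne_top (p.apply_ne_top a)
      ((f a).apply_ne_top b)]
    simp only [ENNReal.toReal_mul]
  simp only [h, Finset.sum_mul, Finset.mul_sum]
  rw [Finset.sum_comm]
  simp only [mul_assoc]

theorem expect_pure (a : α) (g : α → ℝ) : expect (PMF.pure a) g = g a := by
  classical
  rw [expect, Finset.sum_eq_single a]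
  · simp
  · intro b _ hb
    simp [PMF.pure_apply, hb]
  · simp

theorem expect_map (p : PMF α) (f : α → β) (g : β → ℝ) :
    expect (p.map f) g = expect p fun a => g (f a) := by
  rw [← PMF.bind_pure_comp, expect_bind]
  simp only [Function.comp, expect_pure]

theorem expect_uniformOfFinset (s : Finset α) (hs : s.Nonempty) (g : α → ℝ) :
    expect (PMF.uniformOfFinset s hs) g = (∑ a ∈ s, g a) / s.card := by
  classical
  simp only [expect, PMF.uniformOfFinset_apply]
  rw [Finset.sum_div, ← Finset.sum_subset (Finset.subset_univ s)]
  · refine Finset.sum_congr rfl fun a ha => ?_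
    simp [ha]; ring
  · intro a _ ha
    simp [ha]

end Expectation

/-! ### Inclusion probabilities of uniform samples. -/

section Sampling

theorem mem_support_uniformSubset {V : Type*} {S T : Finset V} {m : ℕ}
    (h : T ∈ (uniformSubset S m).support) : T ⊆ S ∧ T.card ≤ m := by
  rw [uniformSubset, PMF.support_uniformOfFinset, Finset.mem_coe, Finset.mem_powersetCard] at h
  exact ⟨h.1, h.2.le.trans (min_le_right _ _)⟩

variable {V : Type*} [DecidableEq V]

/-- Deleting `u` matches the `k`-subsets through `u` with the `(k-1)`-subsets of the rest; the claim
is then the absorption identity for binomial coefficients. -/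
theorem card_filter_mem_powersetCard (S : Finset V) (k : ℕ) {u : V} (hu : u ∈ S) :
    S.card * ((S.powersetCard k).filter fun T => u ∈ T).card =
      k * (S.powersetCard k).card := by
  rcases k with _ | k
  · simp
  obtain ⟨S', hu', rfl⟩ : ∃ S', u ∉ S' ∧ insert u S' = S :=
    ⟨S.erase u, by simp, Finset.insert_erase hu⟩
  have h1 : ((insert u S').powersetCard (k + 1)).filter (fun T => u ∈ T) =
      (S'.powersetCard k).image (insert u) := by
    rw [Finset.powersetCard_succ_insert hu', Finset.filter_union]
    have e1 : (S'.powersetCard (k + 1)).filter (fun T => u ∈ T) = ∅ := by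
      refine Finset.filter_eq_empty_iff.mpr fun T hT hTu => hu' ?_
      exact (Finset.mem_powersetCard.mp hT).1 hTu
    rw [e1, Finset.empty_union, Finset.filter_eq_self]
    intro T hT
    obtain ⟨T', _, rfl⟩ := Finset.mem_image.mp hT
    exact Finset.mem_insert_self _ _
  have h2 : ((S'.powersetCard k).image (insert u)).card = (S'.powersetCard k).card := by
    refine Finset.card_image_of_injOn fun T hT T' hT' h => ?_
    have n1 : u ∉ T := fun h => hu' ((Finset.mem_powersetCard.mp hT).1 h)
    have n2 : u ∉ T' := fun h => hu' ((Finset.mem_powersetCard.mp hT').1 h)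
    rw [← Finset.erase_insert n1, ← Finset.erase_insert n2]
    exact congrArg (fun X => X.erase u) h
  rw [h1, h2, Finset.card_powersetCard, Finset.card_powersetCard, Finset.card_insert_of_notMem hu',
    Nat.add_one_mul_choose_eq, mul_comm]

variable [Fintype V]

theorem expect_mem_uniformSubset {S : Finset V} (m : ℕ) {u : V} (hu : u ∈ S) :
    expect (uniformSubset S m) (fun T => if u ∈ T then 1 else 0) =
      (min S.card m : ℕ) / (S.card : ℝ) := by
  have hS : (0 : ℝ) < S.card := by exact_mod_cast Finset.card_pos.mpr ⟨u, hu⟩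
  have hP : (0 : ℝ) < (S.powersetCard (min S.card m)).card := by
    exact_mod_cast Finset.card_pos.mpr (Finset.powersetCard_nonempty.mpr (min_le_left _ _))
  have h := card_filter_mem_powersetCard S (min S.card m) hu
  have h' : (S.card : ℝ) * (((S.powersetCard (min S.card m)).filter fun T => u ∈ T).card : ℝ) =
      (min S.card m : ℕ) * ((S.powersetCard (min S.card m)).card : ℝ) := by exact_mod_cast h
  rw [uniformSubset, expect_uniformOfFinset, Finset.sum_boole, div_eq_div_iff hP.ne' hS.ne']
  linarith

/-- A vertex of `S` is sampled with probability at least `c` if `c |S| ≤ m`. -/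
theorem le_expect_mem_uniformSubset {S : Finset V} {m : ℕ} {u : V} (hu : u ∈ S) {c : ℝ}
    (hc : c ≤ 1) (hm : c * S.card ≤ m) :
    c ≤ expect (uniformSubset S m) (fun T => if u ∈ T then 1 else 0) := by
  have hS : (0 : ℝ) < S.card := by exact_mod_cast Finset.card_pos.mpr ⟨u, hu⟩
  rw [expect_mem_uniformSubset m hu, le_div_iff₀ hS, Nat.cast_min]
  refine le_min ?_ hm
  nlinarith

end Sampling

/-! ### Partitions of a set of vertices. -/

section Partitions

variable {V : Type*}

/-- The members of `P` are non-empty subsets of `W`, and each element of `W` is in exactly one. -/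
def IsPartitionOf (P : Finset (Finset V)) (W : Finset V) : Prop :=
  ∅ ∉ P ∧ (∀ S ∈ P, S ⊆ W) ∧ ∀ v ∈ W, ∃! S : Finset V, S ∈ P ∧ v ∈ S

/-- The vertices `x` and `y` lie in a common member of `P`. -/
def Joint (P : Finset (Finset V)) (x y : V) : Prop := ∃ S ∈ P, x ∈ S ∧ y ∈ S

instance [DecidableEq V] (P : Finset (Finset V)) (x y : V) : Decidable (Joint P x y) := by
  unfold Joint; infer_instance

variable [DecidableEq V]

theorem IsPartitionOf.union {P Q : Finset (Finset V)} {S T : Finset V} (hP : IsPartitionOf P S)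
    (hQ : IsPartitionOf Q T) (hd : Disjoint S T) : IsPartitionOf (P ∪ Q) (S ∪ T) := by
  obtain ⟨p1, p2, p3⟩ := hP
  obtain ⟨q1, q2, q3⟩ := hQ
  refine ⟨by simp [p1, q1], ?_, ?_⟩
  · intro X hX
    rcases Finset.mem_union.mp hX with h | h
    · exact (p2 X h).trans Finset.subset_union_left
    · exact (q2 X h).trans Finset.subset_union_right
  · intro v hv
    rcases Finset.mem_union.mp hv with h | h
    · obtain ⟨X, ⟨hX, hvX⟩, hu⟩ := p3 v h
      refine ⟨X, ⟨Finset.mem_union_left _ hX, hvX⟩, fun Y hY => ?_⟩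
      rcases Finset.mem_union.mp hY.1 with h' | h'
      · exact hu Y ⟨h', hY.2⟩
      · exact absurd (q2 Y h' hY.2) (Finset.disjoint_left.mp hd h)
    · obtain ⟨X, ⟨hX, hvX⟩, hu⟩ := q3 v h
      refine ⟨X, ⟨Finset.mem_union_right _ hX, hvX⟩, fun Y hY => ?_⟩
      rcases Finset.mem_union.mp hY.1 with h' | h'
      · exact absurd h (Finset.disjoint_left.mp hd (p2 Y h' hY.2))
      · exact hu Y ⟨h', hY.2⟩

omit [DecidableEq V] in
theorem Joint.mem {P : Finset (Finset V)} {W : Finset V} (hP : IsPartitionOf P W) {x y : V}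
    (h : Joint P x y) : x ∈ W ∧ y ∈ W := by
  obtain ⟨S, hS, hx, hy⟩ := h
  exact ⟨hP.2.1 S hS hx, hP.2.1 S hS hy⟩

theorem joint_union {P Q : Finset (Finset V)} {x y : V} :
    Joint (P ∪ Q) x y ↔ Joint P x y ∨ Joint Q x y := by
  simp only [Joint, Finset.mem_union, or_and_right, exists_or]

end Partitions

/-! ### The cost as a sum over ordered pairs. -/

noncomputable section PairCost

variable {V : Type*} [DecidableEq V] (G : SimpleGraph V) [DecidableRel G.Adj]

/-- The contribution of the ordered pair `(x, y)` to the cost of `P`. -/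
def pairCost (P : Finset (Finset V)) (x y : V) : ℝ :=
  if G.Adj x y then (if Joint P x y then 0 else 1)
  else if x = y then 0 else if Joint P x y then 1 else 0

/-- The cost of `P` on the ordered pairs from `W`. -/
def costOn (P : Finset (Finset V)) (W : Finset V) : ℝ := ∑ x ∈ W, ∑ y ∈ W, pairCost G P x y

theorem pairCost_nonneg (P : Finset (Finset V)) (x y : V) : 0 ≤ pairCost G P x y := by
  unfold pairCost; split_ifs <;> norm_num

theorem pairCost_congr {P Q : Finset (Finset V)} {x y : V} (h : Joint P x y ↔ Joint Q x y) :
    pairCost G P x y = pairCost G Q x y := by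
  simp only [pairCost, h]

omit [DecidableEq V] in
theorem joint_comm {P : Finset (Finset V)} {x y : V} : Joint P x y ↔ Joint P y x := by
  simp only [Joint, and_comm (a := x ∈ _)]

theorem pairCost_comm (P : Finset (Finset V)) (x y : V) : pairCost G P x y = pairCost G P y x := by
  simp only [pairCost, joint_comm (x := x), G.adj_comm x, eq_comm (a := x)]

/-- Members of `P` miss `T`, and members of `Q` lie inside it. So pairs within `T` are decided by
`Q` alone, and all others, cross pairs included, by `P` alone. -/
theorem costOn_union {P Q : Finset (Finset V)} {S T : Finset V} (hP : IsPartitionOf P S)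
    (hQ : IsPartitionOf Q T) (hd : Disjoint S T) :
    costOn G (P ∪ Q) (S ∪ T) = costOn G Q T +
      ∑ x ∈ S ∪ T, ∑ y ∈ S ∪ T, if x ∈ T ∧ y ∈ T then 0 else pairCost G P x y := by
  have key : ∀ x y, pairCost G (P ∪ Q) x y = (if x ∈ T ∧ y ∈ T then pairCost G Q x y else 0) +
      if x ∈ T ∧ y ∈ T then 0 else pairCost G P x y := by
    intro x y
    split_ifs with h
    · rw [add_zero]
      refine pairCost_congr G ?_
      rw [joint_union, or_iff_right]
      exact fun h' => Finset.disjoint_right.mp hd h.1 (h'.mem hP).1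
    · rw [zero_add]
      refine pairCost_congr G ?_
      rw [joint_union, or_iff_left]
      exact fun h' => h (h'.mem hQ)
  have hT : costOn G Q T =
      ∑ x ∈ S ∪ T, ∑ y ∈ S ∪ T, if x ∈ T ∧ y ∈ T then pairCost G Q x y else 0 := by
    rw [costOn, ← Finset.sum_subset (Finset.subset_union_right (s₁ := S) (s₂ := T))]
    · refine Finset.sum_congr rfl fun x hx => ?_
      rw [← Finset.sum_subset (Finset.subset_union_right (s₁ := S) (s₂ := T))]
      · exact Finset.sum_congr rfl fun y hy => by rw [if_pos ⟨hx, hy⟩]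
      · intro y _ hy
        rw [if_neg fun h => hy h.2]
    · intro x _ hx
      exact Finset.sum_eq_zero fun y _ => by rw [if_neg fun h => hx h.1]
  rw [hT, costOn, ← Finset.sum_add_distrib]
  refine Finset.sum_congr rfl fun x _ => ?_
  rw [← Finset.sum_add_distrib]
  exact Finset.sum_congr rfl fun y _ => key x y

variable [Fintype V]

omit [DecidableEq V] in
theorem card_filter_adj (H : SimpleGraph V) [DecidableRel H.Adj] :
    2 * (H.edgeFinset.card : ℝ) = ∑ x, ∑ y, if H.Adj x y then 1 else 0 := by
  have h := H.sum_degrees_eq_twice_card_edges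
  have h' : (∑ v, (H.degree v : ℝ)) = 2 * (H.edgeFinset.card : ℝ) := by exact_mod_cast h
  rw [← h']
  refine Finset.sum_congr rfl fun x _ => ?_
  rw [Finset.sum_boole, ← H.card_neighborFinset_eq_degree, H.neighborFinset_eq_filter]

-- The degree-sum formula applied to the subgraph of the edges that satisfy `p`.
omit [DecidableEq V] in
theorem card_filter_edgeFinset (H : SimpleGraph V) [DecidableRel H.Adj] (p : Sym2 V → Prop)
    [DecidablePred p] :
    2 * ((H.edgeFinset.filter p).card : ℝ) =
      ∑ x, ∑ y, if H.Adj x y ∧ p s(x, y) then 1 else 0 := by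
  let H' : SimpleGraph V :=
    { Adj := fun x y => H.Adj x y ∧ p s(x, y)
      symm := ⟨fun x y h => ⟨h.1.symm, by rw [Sym2.eq_swap]; exact h.2⟩⟩
      loopless := ⟨fun x h => H.loopless.irrefl x h.1⟩ }
  let _ : DecidableRel H'.Adj := fun x y => inferInstanceAs (Decidable (H.Adj x y ∧ p s(x, y)))
  have h1 : H'.edgeFinset = H.edgeFinset.filter p := by
    ext e
    induction e using Sym2.ind with
    | _ x y => simp [H']
  rw [← h1, card_filter_adj]

omit [DecidableEq V] [Fintype V] in
theorem together_mk {P : Finset (Finset V)} {x y : V} : Together P s(x, y) ↔ Joint P x y := by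
  simp [Together, Joint]

theorem two_mul_cost (P : Finset (Finset V)) : 2 * (cost G P : ℝ) = costOn G P Finset.univ := by
  rw [cost, Nat.cast_add, mul_add, card_filter_edgeFinset, card_filter_edgeFinset, costOn,
    ← Finset.sum_add_distrib]
  refine Finset.sum_congr rfl fun x _ => ?_
  rw [← Finset.sum_add_distrib]
  refine Finset.sum_congr rfl fun y _ => ?_
  simp only [together_mk, SimpleGraph.compl_adj, pairCost]
  split_ifs <;> simp_all

end PairCost

/-! ### One iteration, and validity of the output. -/

noncomputable section Loop

variable {V : Type*} [DecidableEq V] (G : SimpleGraph V) [DecidableRel G.Adj]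

/-- The joint law of the samples `D'` and `A'` drawn in the iteration with pivot `v`. -/
def sampleLaw (ε δ : ℝ) (R A : Finset V) (v : V) : PMF (Finset V × Finset V) :=
  (uniformSubset (setD G δ R v) (sampleSize G δ R v)).bind fun D' =>
    (uniformSubset (setA G ε R A v) (sampleSize G δ R v)).map fun A' => (D', A')

theorem modifiedPivotLoop_of_nonempty (ε δ : ℝ) (R A : Finset V) (hR : R.Nonempty) :
    modifiedPivotLoop G ε δ R A =
      (uniformVertex R hR).bind fun v => (sampleLaw G ε δ R A v.1).bind fun s =>
        (modifiedPivotLoop G ε δ (R \ setC G R v.1) (A ∪ setA G ε R A v.1)).map fun P =>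
          newClusters G ε R A v.1 s.1 s.2 ∪ P := by
  rw [modifiedPivotLoop, dif_pos hR]
  simp only [sampleLaw, PMF.bind_bind, PMF.bind_map, Function.comp_def]

/-- The cluster of the pivot. -/
def pivotCluster (R A : Finset V) (v : V) (D' A' : Finset V) : Finset V :=
  (setC G R v ∪ A') \ (D' ∪ A)

variable {G} {ε δ : ℝ} {R A : Finset V} {v : V} {D' A' : Finset V}

theorem mem_support_sampleLaw {s : Finset V × Finset V}
    (h : s ∈ (sampleLaw G ε δ R A v).support) :
    (s.1 ⊆ setD G δ R v ∧ s.1.card ≤ sampleSize G δ R v) ∧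
      (s.2 ⊆ setA G ε R A v ∧ s.2.card ≤ sampleSize G δ R v) := by
  rw [sampleLaw, PMF.mem_support_bind_iff] at h
  obtain ⟨D', hD, h⟩ := h
  rw [PMF.mem_support_map_iff] at h
  obtain ⟨A', hA, rfl⟩ := h
  exact ⟨mem_support_uniformSubset hD, mem_support_uniformSubset hA⟩

theorem mem_setA {w : V} : w ∈ setA G ε R A v ↔ (w ∈ R ∧ w ∉ setC G R v) ∧ w ∉ A ∧
    ((symmDiff (nbr G R w) (setC G R v)).card : ℝ) ≤ ε * ((setC G R v).card : ℝ) - 1 := by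
  simp [setA]

theorem setD_subset_setC : setD G δ R v ⊆ setC G R v :=
  (Finset.filter_subset _ _).trans (Finset.subset_insert _ _)

theorem mem_newClusters {S : Finset V} : S ∈ newClusters G ε R A v D' A' ↔
    S ≠ ∅ ∧ (S = pivotCluster G R A v D' A' ∨
      ∃ x, ((x ∈ D' ∧ x ∉ A) ∨ (x ∈ setA G ε R A v ∧ x ∉ A')) ∧ {x} = S) := by
  simp [newClusters, pivotCluster]

theorem joint_newClusters {x y : V} (hxy : x ≠ y) :
    Joint (newClusters G ε R A v D' A') x y ↔
      x ∈ pivotCluster G R A v D' A' ∧ y ∈ pivotCluster G R A v D' A' := by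
  constructor
  · rintro ⟨S, hS, hx, hy⟩
    rcases (mem_newClusters.mp hS).2 with rfl | ⟨z, _, rfl⟩
    · exact ⟨hx, hy⟩
    · rw [Finset.mem_singleton] at hx hy
      exact absurd (hx.trans hy.symm) hxy
  · rintro ⟨hx, hy⟩
    exact ⟨_, mem_newClusters.mpr ⟨Finset.ne_empty_of_mem hx, Or.inl rfl⟩, hx, hy⟩

/-- Vertices of `A` got their cluster in an earlier iteration, so an iteration covers only `C_v \ A`
and the new candidates. -/
theorem isPartitionOf_newClusters (hD : D' ⊆ setD G δ R v) (hA : A' ⊆ setA G ε R A v) :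
    IsPartitionOf (newClusters G ε R A v D' A') ((setC G R v \ A) ∪ setA G ε R A v) := by
  have hDC : ∀ x ∈ D', x ∈ setC G R v := fun x hx => setD_subset_setC (hD hx)
  have hAF : ∀ x ∈ A', x ∈ setA G ε R A v := fun x hx => hA hx
  have hFC : ∀ x ∈ setA G ε R A v, x ∉ setC G R v ∧ x ∉ A := fun x hx =>
    ⟨(mem_setA.mp hx).1.2, (mem_setA.mp hx).2.1⟩
  have hK : ∀ x, x ∈ pivotCluster G R A v D' A' ↔
      (x ∈ setC G R v ∨ x ∈ A') ∧ x ∉ D' ∧ x ∉ A := fun x => by simp [pivotCluster]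
  refine ⟨fun h => (mem_newClusters.mp h).1 rfl, fun S hS x hx => ?_, fun x hx => ?_⟩
  · rw [Finset.mem_union, Finset.mem_sdiff]
    rcases (mem_newClusters.mp hS).2 with rfl | ⟨z, hz, rfl⟩
    · rw [hK] at hx
      have := hAF x
      tauto
    · rw [Finset.mem_singleton] at hx
      subst hx
      have := hDC x
      tauto
  · rw [Finset.mem_union, Finset.mem_sdiff] at hx
    have a1 := hDC x
    have a2 := hAF x
    have a3 := hFC x
    by_cases hxK : x ∈ pivotCluster G R A v D' A'
    · refine ⟨_, ⟨mem_newClusters.mpr ⟨Finset.ne_empty_of_mem hxK, Or.inl rfl⟩, hxK⟩, ?_⟩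
      rintro S ⟨hS, hxS⟩
      rcases (mem_newClusters.mp hS).2 with rfl | ⟨z, hz, rfl⟩
      · rfl
      · rw [Finset.mem_singleton] at hxS
        subst hxS
        rw [hK] at hxK
        tauto
    · refine ⟨{x}, ⟨mem_newClusters.mpr ⟨Finset.singleton_ne_empty x, Or.inr ⟨x, ?_, rfl⟩⟩,
        Finset.mem_singleton_self x⟩, ?_⟩
      · rw [hK] at hxK
        tauto
      · rintro S ⟨hS, hxS⟩
        rcases (mem_newClusters.mp hS).2 with rfl | ⟨z, hz, rfl⟩
        · exact absurd hxS hxK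
        · rw [Finset.mem_singleton] at hxS
          rw [hxS]

theorem setC_subset (hv : v ∈ R) : setC G R v ⊆ R :=
  Finset.insert_subset hv (Finset.filter_subset _ _)

/-- The vertices clustered in an iteration and those clustered later. -/
theorem clustered_union_rest (hv : v ∈ R) :
    ((setC G R v \ A) ∪ setA G ε R A v) ∪ ((R \ setC G R v) \ (A ∪ setA G ε R A v)) = R \ A := by
  ext x
  have h1 := @setC_subset V _ G _ R v hv x
  have h2 := @mem_setA V _ G _ ε R A v x
  simp only [Finset.mem_union, Finset.mem_sdiff]
  tauto

theorem disjoint_clustered_rest :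
    Disjoint ((setC G R v \ A) ∪ setA G ε R A v)
      ((R \ setC G R v) \ (A ∪ setA G ε R A v)) := by
  rw [Finset.disjoint_left]
  intro x
  simp only [Finset.mem_union, Finset.mem_sdiff]
  tauto

theorem isPartitionOf_modifiedPivotLoop (ε δ : ℝ) (R A : Finset V) :
    ∀ P ∈ (modifiedPivotLoop G ε δ R A).support, IsPartitionOf P (R \ A) := by
  induction h : R.card using Nat.strong_induction_on generalizing R A with
  | _ n ih =>
    subst h
    intro P hP
    by_cases hR : R.Nonempty
    · rw [modifiedPivotLoop_of_nonempty G ε δ R A hR] at hP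
      obtain ⟨v, _, hP⟩ := (PMF.mem_support_bind_iff _ _ _).mp hP
      obtain ⟨s, hs, hP⟩ := (PMF.mem_support_bind_iff _ _ _).mp hP
      obtain ⟨P', hP', rfl⟩ := (PMF.mem_support_map_iff _ _ _).mp hP
      have hs' := mem_support_sampleLaw hs
      have h1 := isPartitionOf_newClusters hs'.1.1 hs'.2.1
      have h2 := ih _ (card_sdiff_setC_lt G R v.1 v.2) _ (A ∪ setA G ε R A v.1) rfl P' hP'
      rw [← clustered_union_rest (G := G) (ε := ε) (A := A) v.2]
      exact h1.union h2 disjoint_clustered_rest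
    · rw [modifiedPivotLoop, dif_neg hR, PMF.support_pure, Set.mem_singleton_iff] at hP
      subst hP
      rw [Finset.not_nonempty_iff_eq_empty.mp hR, Finset.empty_sdiff]
      exact ⟨by simp, by simp, by simp⟩

omit [DecidableEq V] in
theorem IsPartitionOf.isClustering [Fintype V] {P : Finset (Finset V)}
    (h : IsPartitionOf P Finset.univ) : IsClustering P :=
  ⟨h.1, fun v => h.2.2 v (Finset.mem_univ v)⟩

end Loop

/-! ### Charges to triangles through the pivot. -/

noncomputable section Charges

variable {V : Type*} [DecidableEq V] (G : SimpleGraph V) [DecidableRel G.Adj]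

/-- The relations between the sets of one iteration: the decided vertices `A`, the neighbourhood
`C` of the pivot, the candidates `F` for joining it, and the samples `D'` and `F'`. -/
structure Admissible (A C F D' F' : Finset V) : Prop where
  subset_C : ∀ x ∈ D', x ∈ C
  subset_F : ∀ x ∈ F', x ∈ F
  notMem_C : ∀ x ∈ F, x ∉ C
  notMem_A : ∀ x ∈ F, x ∉ A

/-- The mistakes that the plain pivot algorithm makes too. -/
def mainCharge (A C D' F' : Finset V) (x y : V) : ℝ :=
  if x ∈ C then
    if y ∈ C then if x ≠ y ∧ ¬ G.Adj x y ∧ x ∉ D' ∧ y ∉ D' then 1 else 0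
    else if G.Adj x y ∧ y ∉ A ∧ (y ∈ F' → x ∈ D') then 1 else 0
  else
    if y ∈ C then if G.Adj x y ∧ x ∉ A ∧ (x ∈ F' → y ∈ D') then 1 else 0
    else 0

/-- The further mistakes, charged to their endpoint `x`. -/
def extraCost (C F D' F' : Finset V) (x y : V) : ℝ :=
  (if x ∈ D' ∧ y ∈ C ∧ G.Adj x y then 1 else 0) + (if x ∈ F ∧ y ∉ C ∧ G.Adj x y then 1 else 0) +
    (if x ∈ F' ∧ y ∈ C ∧ ¬ G.Adj x y then 1 else 0) + (if x ∈ F' ∧ y ∈ F' then 1 / 2 else 0)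

/-- The further mistakes, redistributed to bad triangles through the pivot. -/
def extraCharge (C F D' F' : Finset V) (x y : V) : ℝ :=
  if y ∈ C then
    if G.Adj x y then
      if x ∈ F' then (if y ∈ D' then 0 else 0.12) else if x ∈ F then 0.0071 else 0
    else if x ≠ y ∧ x ∈ D' then 0.2181 else 0
  else 0

/-- The total charge to the triangle formed by the pivot, `x` and `y`. -/
def charge (A C F D' F' : Finset V) (x y : V) : ℝ :=
  mainCharge G A C D' F' x y + extraCharge G C F D' F' x y + extraCharge G C F D' F' y x

theorem mainCharge_comm (A C D' F' : Finset V) (x y : V) :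
    mainCharge G A C D' F' x y = mainCharge G A C D' F' y x := by
  by_cases hx : x ∈ C <;> by_cases hy : y ∈ C <;>
    simp only [mainCharge, hx, hy, if_true, if_false, G.adj_comm x y, ne_comm (a := x),
      and_comm (a := x ∉ D')]

theorem charge_comm (A C F D' F' : Finset V) (x y : V) :
    charge G A C F D' F' x y = charge G A C F D' F' y x := by
  rw [charge, charge, mainCharge_comm]
  ring

theorem extraCost_nonneg (C F D' F' : Finset V) (x y : V) : 0 ≤ extraCost G C F D' F' x y := by
  unfold extraCost; positivity

theorem extraCharge_nonneg (C F D' F' : Finset V) (x y : V) :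
    0 ≤ extraCharge G C F D' F' x y := by
  unfold extraCharge; split_ifs <;> norm_num

theorem mainCharge_nonneg (A C D' F' : Finset V) (x y : V) :
    0 ≤ mainCharge G A C D' F' x y := by
  unfold mainCharge; split_ifs <;> norm_num

theorem charge_nonneg (A C F D' F' : Finset V) (x y : V) : 0 ≤ charge G A C F D' F' x y :=
  add_nonneg (add_nonneg (mainCharge_nonneg ..) (extraCharge_nonneg ..)) (extraCharge_nonneg ..)

variable {G} {A C F D' F' : Finset V} {x y : V}

/-- This and the next three lemmas show that only bad triangles are charged. -/
theorem charge_eq_zero_of_adj (h : Admissible A C F D' F') (hx : x ∈ C) (hy : y ∈ C)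
    (hxy : G.Adj x y) : charge G A C F D' F' x y = 0 := by
  have hx1 : x ∉ F := fun hF => h.notMem_C x hF hx
  have hy1 : y ∉ F := fun hF => h.notMem_C y hF hy
  have hx2 : x ∉ F' := fun hF => hx1 (h.subset_F x hF)
  have hy2 : y ∉ F' := fun hF => hy1 (h.subset_F y hF)
  simp [charge, mainCharge, extraCharge, hx, hy, hxy, hxy.symm, hx1, hy1, hx2, hy2]

theorem charge_self : charge G A C F D' F' x x = 0 := by
  simp [charge, mainCharge, extraCharge]

theorem charge_eq_zero_of_not_adj (h : Admissible A C F D' F') (hy : y ∉ C)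
    (hxy : ¬ G.Adj x y) : charge G A C F D' F' x y = 0 := by
  have hyx : ¬ G.Adj y x := fun h => hxy h.symm
  have hy1 : y ∉ D' := fun hD => hy (h.subset_C y hD)
  simp [charge, mainCharge, extraCharge, hy, hxy, hyx, hy1]

theorem charge_eq_zero_of_notMem (hx : x ∉ C) (hy : y ∉ C) :
    charge G A C F D' F' x y = 0 := by
  simp [charge, mainCharge, extraCharge, hx, hy]

/-- Removing `x` cancels the unit charge and leaves at most one extra charge per endpoint; `0.5638 =
1 - 2 · 0.2181`. -/
theorem charge_le_of_mem (h : Admissible A C F D' F') (hx : x ∈ C) (hy : y ∈ C) :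
    charge G A C F D' F' x y ≤ 1 - 0.5638 * (if x ∈ D' then 1 else 0) := by
  have hx1 : x ∉ F := fun hF => h.notMem_C x hF hx
  have hy1 : y ∉ F := fun hF => h.notMem_C y hF hy
  have hx2 : x ∉ F' := fun hF => hx1 (h.subset_F x hF)
  have hy2 : y ∉ F' := fun hF => hy1 (h.subset_F y hF)
  by_cases hxy : G.Adj x y
  · rw [charge_eq_zero_of_adj h hx hy hxy]
    split_ifs <;> norm_num
  have hyx : ¬ G.Adj y x := fun h => hxy h.symm
  by_cases a : x ∈ D' <;> by_cases b : y ∈ D' <;> by_cases e : x = y <;>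
    simp [charge, mainCharge, extraCharge, hx, hy, hxy, hyx, a, b, e, eq_comm (a := y)] <;>
    norm_num

/-- If `y` joins the pivot's cluster, the edge `xy` is cut only when `x` is removed, and then no
extra charge is placed on it. If `y` was clustered earlier, its pairs are already paid for. -/
theorem charge_le_of_notMem (h : Admissible A C F D' F') (hx : x ∈ C) (hy : y ∉ C) :
    charge G A C F D' F' x y ≤
      (if y ∈ F' then 0.12 + if x ∈ D' then 1 else 0 else
        if y ∈ F then 1.0071 else if y ∈ A then 0 else 1) ∧
      charge G A C F D' F' x y ≤ 1.0071 := by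
  by_cases hxy : G.Adj x y
  · have hyx := hxy.symm
    by_cases a : y ∈ F'
    · have b := h.subset_F y a
      have c := h.notMem_A y b
      by_cases d : x ∈ D' <;>
        simp [charge, mainCharge, extraCharge, hx, hy, hxy, hyx, a, c, d] <;> norm_num
    · by_cases b : y ∈ F
      · have c := h.notMem_A y b
        simp [charge, mainCharge, extraCharge, hx, hy, hxy, hyx, a, b, c]
        norm_num
      · by_cases c : y ∈ A <;>
          simp [charge, mainCharge, extraCharge, hx, hy, hxy, hyx, a, b, c] <;> norm_num
  · rw [charge_eq_zero_of_not_adj h hy hxy]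
    constructor
    · split_ifs <;> norm_num
    · norm_num

end Charges

/-! ### The charges cover the cost of an iteration. -/

noncomputable section Iteration

variable {V : Type*} [DecidableEq V] {G : SimpleGraph V} [DecidableRel G.Adj]
  {ε δ : ℝ} {R A : Finset V} {v : V} {D' A' : Finset V}

theorem admissible (hD : D' ⊆ setD G δ R v) (hA : A' ⊆ setA G ε R A v) :
    Admissible A (setC G R v) (setA G ε R A v) D' A' where
  subset_C := fun _ hx => setD_subset_setC (hD hx)
  subset_F := fun _ hx => hA hx
  notMem_C := fun _ hx => (mem_setA.mp hx).1.2
  notMem_A := fun _ hx => (mem_setA.mp hx).2.1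

/-- Only the pivot's cluster can join two distinct vertices, so a mistake is read off from
membership of `x` and `y` in it; the cases follow which of them lie in `C_v`. -/
theorem pairCost_newClusters_le (hD : D' ⊆ setD G δ R v) (hA : A' ⊆ setA G ε R A v) {x y : V}
    (hx : x ∉ A) (hy : y ∉ A)
    (hxy : (x ∈ setC G R v ∨ x ∈ setA G ε R A v) ∨ (y ∈ setC G R v ∨ y ∈ setA G ε R A v)) :
    pairCost G (newClusters G ε R A v D' A') x y ≤ mainCharge G A (setC G R v) D' A' x y +
      extraCost G (setC G R v) (setA G ε R A v) D' A' x y +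
      extraCost G (setC G R v) (setA G ε R A v) D' A' y x := by
  have h := admissible hD hA
  have h0 := mainCharge_nonneg G A (setC G R v) D' A' x y
  have h1 := extraCost_nonneg G (setC G R v) (setA G ε R A v) D' A' x y
  have h2 := extraCost_nonneg G (setC G R v) (setA G ε R A v) D' A' y x
  by_cases e : x = y
  · subst e
    simp only [pairCost, G.irrefl, if_false, if_true]
    linarith
  have hK : ∀ z, z ∈ pivotCluster G R A v D' A' ↔
      (z ∈ setC G R v ∨ z ∈ A') ∧ z ∉ D' ∧ z ∉ A := fun z => by simp [pivotCluster]
  simp only [pairCost, joint_newClusters e, hK, hx, hy, e, if_false, not_false_eq_true, and_true]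
  generalize setC G R v = C at *
  generalize setA G ε R A v = F at *
  have x1 := h.subset_C x
  have y1 := h.subset_C y
  by_cases hE : G.Adj x y
  · have hE' := hE.symm
    simp only [hE, if_true]
    split_ifs with hj
    · linarith
    by_cases cx : x ∈ C <;> by_cases cy : y ∈ C
    · have : x ∈ D' ∨ y ∈ D' := by
        by_contra! hc
        exact hj ⟨⟨Or.inl cx, hc.1⟩, Or.inl cy, hc.2⟩
      rcases this with d | d
      · have : (1 : ℝ) ≤ extraCost G C F D' A' x y := by
          simp only [extraCost, d, cy, hE, and_self, if_true, not_true, and_false, false_and,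
            if_false]
          split_ifs <;> norm_num
        linarith
      · have : (1 : ℝ) ≤ extraCost G C F D' A' y x := by
          simp only [extraCost, d, cx, hE', and_self, if_true, not_true, and_false, false_and,
            if_false]
          split_ifs <;> norm_num
        linarith
    · have : mainCharge G A C D' A' x y = 1 := by
        simp only [mainCharge, cx, cy, if_true, if_false, hE, hy, not_false_eq_true, true_and]
        rw [if_pos]
        exact fun hyF => by_contra fun hxD =>
          hj ⟨⟨Or.inl cx, hxD⟩, Or.inr hyF, fun d => cy (y1 d)⟩
      linarith
    · have : mainCharge G A C D' A' x y = 1 := by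
        simp only [mainCharge, cx, cy, if_true, if_false, hE, hx, not_false_eq_true, true_and]
        rw [if_pos]
        exact fun hxF => by_contra fun hyD =>
          hj ⟨⟨Or.inr hxF, fun d => cx (x1 d)⟩, Or.inl cy, hyD⟩
      linarith
    · have : x ∈ F ∨ y ∈ F := by simpa only [cx, cy, false_or] using hxy
      rcases this with d | d
      · have : (1 : ℝ) ≤ extraCost G C F D' A' x y := by
          simp only [extraCost, d, cy, hE, and_self, if_true, not_true, and_false, false_and,
            if_false, not_false_eq_true]
          split_ifs <;> norm_num
        linarith
      · have : (1 : ℝ) ≤ extraCost G C F D' A' y x := by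
          simp only [extraCost, d, cx, hE', and_self, if_true, not_true, and_false, false_and,
            if_false, not_false_eq_true]
          split_ifs <;> norm_num
        linarith
  · have hE' : ¬ G.Adj y x := fun h => hE h.symm
    simp only [hE, if_false]
    split_ifs with hj
    · by_cases cx : x ∈ C <;> by_cases cy : y ∈ C
      · have : mainCharge G A C D' A' x y = 1 := by
          simp only [mainCharge, cx, cy, if_true, hE, ne_eq, e, hj.1.2, hj.2.2, not_false_eq_true,
            and_self]
        linarith
      · have d : y ∈ A' := hj.2.1.resolve_left cy
        have : (1 : ℝ) ≤ extraCost G C F D' A' y x := by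
          simp only [extraCost, d, cx, hE', if_true, not_true, and_false,
            if_false, not_false_eq_true, true_and]
          split_ifs <;> norm_num
        linarith
      · have d : x ∈ A' := hj.1.1.resolve_left cx
        have : (1 : ℝ) ≤ extraCost G C F D' A' x y := by
          simp only [extraCost, d, cy, hE, if_true, not_true, and_false,
            if_false, not_false_eq_true, true_and]
          split_ifs <;> norm_num
        linarith
      · have d : x ∈ A' := hj.1.1.resolve_left cx
        have d' : y ∈ A' := hj.2.1.resolve_left cy
        -- A non-edge inside `A'` is shared by its two endpoints, hence the weight one half.
        have t1 : extraCost G C F D' A' x y = 1 / 2 := by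
          simp [extraCost, d, d', cy, hE]
        have t2 : extraCost G C F D' A' y x = 1 / 2 := by
          simp [extraCost, d, d', cx, hE']
        linarith
    · linarith

omit [DecidableEq V] in
theorem mem_nbr {x y : V} : y ∈ nbr G R x ↔ y ∈ R ∧ G.Adj x y := by simp [nbr]

theorem mem_setC {x : V} : x ∈ setC G R v ↔ x = v ∨ x ∈ R ∧ G.Adj v x := by
  simp [setC, mem_nbr]

/-- The further mistakes charged to a vertex are covered by its extra charges. -/
theorem sum_extraCost_le (hv : v ∈ R) {x : V} (hD : D' ⊆ setD G 0.179 R v)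
    (hA : A' ⊆ setA G 0.007 R A v) (hDc : D'.card ≤ sampleSize G 0.179 R v)
    (hAc : A'.card ≤ sampleSize G 0.179 R v) :
    ∑ y ∈ R, extraCost G (setC G R v) (setA G 0.007 R A v) D' A' x y ≤
      ∑ y ∈ R, extraCharge G (setC G R v) (setA G 0.007 R A v) D' A' x y := by
  have h := admissible hD hA
  have hCR := setC_subset (G := G) hv
  have hn : (sampleSize G 0.179 R v : ℝ) ≤ 0.179 * ((setC G R v).card : ℝ) :=
    Nat.floor_le (by positivity)
  have hDc' : (D'.card : ℝ) ≤ 0.179 * ((setC G R v).card : ℝ) :=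
    le_trans (by exact_mod_cast hDc) hn
  have hAc' : (A'.card : ℝ) ≤ 0.179 * ((setC G R v).card : ℝ) :=
    le_trans (by exact_mod_cast hAc) hn
  have hxD : x ∈ D' → ((nbr G R x ∩ setC G R v).card : ℝ) ≤
      0.179 * ((setC G R v).card : ℝ) - 1 := fun hx => (Finset.mem_filter.mp (hD hx)).2
  have hxF : x ∈ setA G 0.007 R A v → ((symmDiff (nbr G R x) (setC G R v)).card : ℝ) ≤
      0.007 * ((setC G R v).card : ℝ) - 1 := fun hx => (mem_setA.mp hx).2.2
  have hA'R : A' ⊆ R := fun w hw => (mem_setA.mp (hA hw)).1.1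
  generalize setC G R v = C at *
  generalize setA G 0.007 R A v = F at *
  by_cases x1 : x ∈ D'
  · have xC := h.subset_C x x1
    have xF : x ∉ F := fun hF => h.notMem_C x hF xC
    have xF' : x ∉ A' := fun hF => xF (h.subset_F x hF)
    have e1 : ∑ y ∈ R, extraCost G C F D' A' x y = ((nbr G R x ∩ C).card : ℝ) := by
      simp only [extraCost, x1, xF, xF', false_and, if_false, add_zero, true_and]
      rw [Finset.sum_boole]
      congr 2
      ext y
      simp only [Finset.mem_filter, Finset.mem_inter, mem_nbr]
      tauto
    have e2 : ∑ y ∈ R, extraCharge G C F D' A' x y =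
        ((C \ insert x (nbr G R x ∩ C)).card : ℝ) * 0.2181 := by
      simp only [extraCharge, x1, xF, xF', if_false]
      rw [← nsmul_eq_mul, ← Finset.sum_const, ← Finset.sum_subset (Finset.sdiff_subset.trans hCR)]
      · refine Finset.sum_congr rfl fun y hy => ?_
        simp only [Finset.mem_sdiff, Finset.mem_insert, Finset.mem_inter, mem_nbr, not_or] at hy
        have := hCR hy.1
        have h3 : ¬ G.Adj x y := by tauto
        simp [hy.1, h3, Ne.symm hy.2.1]
      · intro y hyR hy
        simp only [Finset.mem_sdiff, Finset.mem_insert, Finset.mem_inter, mem_nbr] at hy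
        by_cases yC : y ∈ C
        · by_cases hE : G.Adj x y
          · simp [hE]
          · have : x = y := by
              have := hCR yC
              tauto
            simp [this]
        · simp [yC]
    have e3 : (insert x (nbr G R x ∩ C)).card = (nbr G R x ∩ C).card + 1 :=
      Finset.card_insert_of_notMem (by simp [mem_nbr])
    have e4 : (C \ insert x (nbr G R x ∩ C)).card + (insert x (nbr G R x ∩ C)).card = C.card :=
      Finset.card_sdiff_add_card_eq_card
        (Finset.insert_subset xC Finset.inter_subset_right)
    have e5 : ((C \ insert x (nbr G R x ∩ C)).card : ℝ) + ((nbr G R x ∩ C).card + 1) = C.card := by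
      rw [e3] at e4
      exact_mod_cast e4
    have := hxD x1
    rw [e1, e2]
    linarith
  · by_cases x2 : x ∈ F
    · have xC := h.notMem_C x x2
      have hs := hxF x2
      have c1 : ((nbr G R x \ C).card : ℝ) + ((C \ nbr G R x).card : ℝ) =
          ((symmDiff (nbr G R x) C).card : ℝ) := by
        rw [symmDiff_def, Finset.sup_eq_union, Finset.card_union_of_disjoint]
        · push_cast; rfl
        · exact disjoint_sdiff_sdiff
      have c2 : ((C \ nbr G R x).card : ℝ) + ((nbr G R x ∩ C).card : ℝ) = C.card := by
        have := Finset.card_sdiff_add_card_inter C (nbr G R x)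
        rw [Finset.inter_comm] at this
        exact_mod_cast this
      have s1 : ∑ y ∈ R, (if x ∈ F ∧ y ∉ C ∧ G.Adj x y then (1 : ℝ) else 0) =
          ((nbr G R x \ C).card : ℝ) := by
        rw [Finset.sum_boole]
        congr 2
        ext y
        simp only [Finset.mem_filter, Finset.mem_sdiff, mem_nbr]
        tauto
      by_cases x3 : x ∈ A'
      · have s2 : ∑ y ∈ R, (if x ∈ A' ∧ y ∈ C ∧ ¬ G.Adj x y then (1 : ℝ) else 0) =
            ((C \ nbr G R x).card : ℝ) := by
          rw [Finset.sum_boole]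
          congr 2
          ext y
          have := @hCR y
          simp only [Finset.mem_filter, Finset.mem_sdiff, mem_nbr]
          tauto
        have s3 : ∑ y ∈ R, (if x ∈ A' ∧ y ∈ A' then (1 / 2 : ℝ) else 0) =
            (A'.card : ℝ) * (1 / 2) := by
          rw [← nsmul_eq_mul, ← Finset.sum_const, ← Finset.sum_subset hA'R]
          · exact Finset.sum_congr rfl fun y hy => by simp [x3, hy]
          · intro y _ hy
            simp [hy]
        have e1 : ∑ y ∈ R, extraCost G C F D' A' x y = ((nbr G R x \ C).card : ℝ) +
            ((C \ nbr G R x).card : ℝ) + (A'.card : ℝ) * (1 / 2) := by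
          simp only [extraCost, Finset.sum_add_distrib, s1, s2, s3]
          simp [x1]
        have e2 : ∑ y ∈ R, extraCharge G C F D' A' x y =
            (((nbr G R x ∩ C) \ D').card : ℝ) * 0.12 := by
          simp only [extraCharge, x1, x3, if_true, and_false, if_false]
          rw [← nsmul_eq_mul, ← Finset.sum_const, ← Finset.sum_subset
            (Finset.sdiff_subset.trans (Finset.inter_subset_right.trans hCR))]
          · refine Finset.sum_congr rfl fun y hy => ?_
            simp only [Finset.mem_sdiff, Finset.mem_inter, mem_nbr] at hy
            simp [hy]
          · intro y hyR hy
            simp only [Finset.mem_sdiff, Finset.mem_inter, mem_nbr] at hy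
            split_ifs <;> tauto
        have e3 : ((nbr G R x ∩ C).card : ℝ) ≤ (((nbr G R x ∩ C) \ D').card : ℝ) + D'.card := by
          have := Finset.le_card_sdiff D' (nbr G R x ∩ C)
          have h' : (nbr G R x ∩ C).card ≤ ((nbr G R x ∩ C) \ D').card + D'.card := by omega
          exact_mod_cast h'
        rw [e1, e2]
        have : (0 : ℝ) ≤ ((nbr G R x \ C).card : ℝ) := by positivity
        -- The mistakes number at most `(0.007 + 0.179 / 2) |C|`, and at least `(0.993 - 0.179) |C|`
        -- neighbours outside `D'` pay `0.12` each.
        linarith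
      · have e1 : ∑ y ∈ R, extraCost G C F D' A' x y = ((nbr G R x \ C).card : ℝ) := by
          simp only [extraCost, Finset.sum_add_distrib, s1]
          simp [x1, x3]
        have e2 : ∑ y ∈ R, extraCharge G C F D' A' x y =
            ((nbr G R x ∩ C).card : ℝ) * 0.0071 := by
          simp only [extraCharge, x1, x2, x3, if_true, and_false, if_false]
          rw [← nsmul_eq_mul, ← Finset.sum_const, ← Finset.sum_subset
            (Finset.inter_subset_right.trans hCR)]
          · refine Finset.sum_congr rfl fun y hy => ?_
            simp only [Finset.mem_inter, mem_nbr] at hy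
            simp [hy]
          · intro y hyR hy
            simp only [Finset.mem_inter, mem_nbr] at hy
            split_ifs <;> tauto
        rw [e1, e2]
        have : (0 : ℝ) ≤ ((C \ nbr G R x).card : ℝ) := by positivity
        -- Here `0.007 / 0.993 < 0.0071`.
        linarith
    · have x3 : x ∉ A' := fun hx => x2 (h.subset_F x hx)
      have e1 : ∑ y ∈ R, extraCost G C F D' A' x y = 0 := by
        simp [extraCost, x1, x2, x3]
      rw [e1]
      exact Finset.sum_nonneg fun y _ => extraCharge_nonneg ..

/-- The cost decided in one iteration is at most the sum of the charges. -/
theorem iteration_cost_le (hv : v ∈ R) (hD : D' ⊆ setD G 0.179 R v)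
    (hA : A' ⊆ setA G 0.007 R A v) (hDc : D'.card ≤ sampleSize G 0.179 R v)
    (hAc : A'.card ≤ sampleSize G 0.179 R v) :
    (∑ x ∈ R \ A, ∑ y ∈ R \ A,
      if x ∈ (R \ setC G R v) \ (A ∪ setA G 0.007 R A v) ∧
          y ∈ (R \ setC G R v) \ (A ∪ setA G 0.007 R A v) then 0
      else pairCost G (newClusters G 0.007 R A v D' A') x y) ≤
    ∑ x ∈ R, ∑ y ∈ R, charge G A (setC G R v) (setA G 0.007 R A v) D' A' x y := by
  set b : V → V → ℝ := fun x y => mainCharge G A (setC G R v) D' A' x y +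
      extraCost G (setC G R v) (setA G 0.007 R A v) D' A' x y +
      extraCost G (setC G R v) (setA G 0.007 R A v) D' A' y x with hb
  have hb0 : ∀ x y, 0 ≤ b x y := fun x y =>
    add_nonneg (add_nonneg (mainCharge_nonneg ..) (extraCost_nonneg ..)) (extraCost_nonneg ..)
  calc _ ≤ ∑ x ∈ R \ A, ∑ y ∈ R \ A, b x y := by
        refine Finset.sum_le_sum fun x hx => Finset.sum_le_sum fun y hy => ?_
        rw [Finset.mem_sdiff] at hx hy
        split_ifs with hxy
        · exact hb0 x y
        · refine pairCost_newClusters_le hD hA hx.2 hy.2 ?_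
          simp only [Finset.mem_sdiff, Finset.mem_union] at hxy
          tauto
    _ ≤ ∑ x ∈ R, ∑ y ∈ R, b x y := by
        refine (Finset.sum_le_sum_of_subset_of_nonneg Finset.sdiff_subset
          fun x _ _ => Finset.sum_nonneg fun y _ => hb0 x y).trans ?_
        exact Finset.sum_le_sum fun x _ => Finset.sum_le_sum_of_subset_of_nonneg
          Finset.sdiff_subset fun y _ _ => hb0 x y
    _ ≤ _ := by
        have h1 : ∑ x ∈ R, ∑ y ∈ R, extraCost G (setC G R v) (setA G 0.007 R A v) D' A' x y ≤
            ∑ x ∈ R, ∑ y ∈ R, extraCharge G (setC G R v) (setA G 0.007 R A v) D' A' x y :=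
          Finset.sum_le_sum fun x _ => sum_extraCost_le hv hD hA hDc hAc
        -- Transposing both double sums covers the mistakes charged to the second endpoint.
        have h2 := h1
        rw [Finset.sum_comm, Finset.sum_comm (f := fun x y =>
          extraCharge G (setC G R v) (setA G 0.007 R A v) D' A' x y)] at h2
        simp only [hb, charge, Finset.sum_add_distrib]
        linarith

end Iteration

/-! ### Expected charges and the core estimate. -/

noncomputable section PairSums

variable {V : Type*} [DecidableEq V] [Fintype V] (G : SimpleGraph V) [DecidableRel G.Adj]

theorem expect_sampleLaw_fst (ε δ : ℝ) (R A : Finset V) (v : V) (f : Finset V → ℝ) :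
    expect (sampleLaw G ε δ R A v) (fun s => f s.1) =
      expect (uniformSubset (setD G δ R v) (sampleSize G δ R v)) f := by
  simp only [sampleLaw, expect_bind, expect_map, expect_const]

theorem expect_sampleLaw_snd (ε δ : ℝ) (R A : Finset V) (v : V) (f : Finset V → ℝ) :
    expect (sampleLaw G ε δ R A v) (fun s => f s.2) =
      expect (uniformSubset (setA G ε R A v) (sampleSize G δ R v)) f := by
  simp only [sampleLaw, expect_bind, expect_map, expect_const]

/-- The expected charge to the triangle formed by the pivot `v`, `x` and `y`. -/
def meanCharge (R A : Finset V) (v x y : V) : ℝ :=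
  expect (sampleLaw G 0.007 0.179 R A v) fun s =>
    charge G A (setC G R v) (setA G 0.007 R A v) s.1 s.2 x y

/-- The probability that `u` is removed from the cluster of the pivot `v`. -/
def removalProb (R : Finset V) (v u : V) : ℝ :=
  expect (uniformSubset (setD G 0.179 R v) (sampleSize G 0.179 R v))
    fun T => if u ∈ T then 1 else 0

/-- The probability that `w` joins the cluster of the pivot `v`. -/
def joinProb (R A : Finset V) (v w : V) : ℝ :=
  expect (uniformSubset (setA G 0.007 R A v) (sampleSize G 0.179 R v))
    fun T => if w ∈ T then 1 else 0

theorem meanCharge_comm (R A : Finset V) (v x y : V) :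
    meanCharge G R A v x y = meanCharge G R A v y x := by
  simp only [meanCharge, charge_comm G _ _ _ _ _ x y]

theorem meanCharge_nonneg (R A : Finset V) (v x y : V) : 0 ≤ meanCharge G R A v x y :=
  expect_nonneg _ fun _ _ => charge_nonneg ..

theorem removalProb_nonneg (R : Finset V) (v u : V) : 0 ≤ removalProb G R v u :=
  expect_nonneg _ fun _ _ => by positivity

variable {G} {R A : Finset V} {v x y : V}

omit [Fintype V] in
theorem admissible_of_mem_support {s : Finset V × Finset V} {ε δ : ℝ}
    (hs : s ∈ (sampleLaw G ε δ R A v).support) :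
    Admissible A (setC G R v) (setA G ε R A v) s.1 s.2 :=
  admissible (mem_support_sampleLaw hs).1.1 (mem_support_sampleLaw hs).2.1

theorem meanCharge_eq_zero_of_adj (hx : x ∈ setC G R v) (hy : y ∈ setC G R v)
    (hxy : G.Adj x y) : meanCharge G R A v x y = 0 := by
  rw [meanCharge, expect_congr _ fun s hs =>
    charge_eq_zero_of_adj (admissible_of_mem_support hs) hx hy hxy, expect_const]

theorem meanCharge_self : meanCharge G R A v x x = 0 := by
  simp only [meanCharge, charge_self, expect_const]

theorem meanCharge_eq_zero_of_not_adj (hy : y ∉ setC G R v) (hxy : ¬ G.Adj x y) :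
    meanCharge G R A v x y = 0 := by
  rw [meanCharge, expect_congr _ fun s hs =>
    charge_eq_zero_of_not_adj (admissible_of_mem_support hs) hy hxy, expect_const]

theorem meanCharge_eq_zero_of_notMem (hx : x ∉ setC G R v) (hy : y ∉ setC G R v) :
    meanCharge G R A v x y = 0 := by
  simp only [meanCharge, charge_eq_zero_of_notMem hx hy, expect_const]

theorem meanCharge_le_of_mem (hx : x ∈ setC G R v) (hy : y ∈ setC G R v) :
    meanCharge G R A v x y ≤ 1 - 0.5638 * removalProb G R v x := by
  refine (expect_mono _ fun s hs =>
    charge_le_of_mem (admissible_of_mem_support hs) hx hy).trans_eq ?_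
  rw [expect_sub, expect_const]
  simp only [mul_comm (0.5638 : ℝ)]
  rw [expect_mul_const]
  exact congrArg (fun t => 1 - t * 0.5638)
    (expect_sampleLaw_fst G 0.007 0.179 R A v fun T => if x ∈ T then 1 else 0)

theorem meanCharge_le_of_notMem (hx : x ∈ setC G R v) (hy : y ∉ setC G R v) :
    meanCharge G R A v x y ≤ 1.0071 := by
  refine expect_le_const _ fun s hs => ?_
  have ha := admissible_of_mem_support (G := G) hs
  exact (charge_le_of_notMem (G := G) ha hx hy).2

theorem meanCharge_le_of_notMem_setA (hx : x ∈ setC G R v) (hy : y ∉ setC G R v)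
    (hF : y ∉ setA G 0.007 R A v) : meanCharge G R A v x y ≤ if y ∈ A then 0 else 1 := by
  refine expect_le_const _ fun s hs => ?_
  have ha := admissible_of_mem_support hs
  have h := (charge_le_of_notMem (G := G) ha hx hy).1
  rwa [if_neg fun h' => hF (ha.subset_F y h'), if_neg hF] at h

omit [Fintype V] in
theorem sampleSize_le (δ : ℝ) (hδ : 0 ≤ δ) :
    (sampleSize G δ R v : ℝ) ≤ δ * ((setC G R v).card : ℝ) :=
  Nat.floor_le (by positivity)

omit [Fintype V] in
theorem lt_sampleSize (δ : ℝ) : δ * ((setC G R v).card : ℝ) - 1 < sampleSize G δ R v :=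
  Nat.sub_one_lt_floor _

/-- The charges to the triangles through the pivot and a candidate `y` for joining its cluster. -/
theorem sum_meanCharge_le_of_mem_setA {T : Finset V} (hT : T ⊆ setC G R v)
    (hy : y ∈ setA G 0.007 R A v) : ∑ x ∈ T, meanCharge G R A v x y ≤ 1.0071 * T.card -
      joinProb G R A v y * (0.8871 * T.card - 0.179 * (setC G R v).card) := by
  have hyC : y ∉ setC G R v := (mem_setA.mp hy).1.2
  have key : ∀ s ∈ (sampleLaw G 0.007 0.179 R A v).support,
      ∑ x ∈ T, charge G A (setC G R v) (setA G 0.007 R A v) s.1 s.2 x y ≤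
        1.0071 * T.card - (if y ∈ s.2 then 1 else 0) *
          (0.8871 * T.card - 0.179 * (setC G R v).card) := by
    intro s hs
    have ha := admissible_of_mem_support hs
    by_cases h : y ∈ s.2
    -- Once `y` joins, each `x` carries `0.12`, plus 1 for the at most `0.179 |C_v|` removed
    -- vertices; `0.8871 = 1.0071 - 0.12`.
    · have h1 : ∑ x ∈ T, charge G A (setC G R v) (setA G 0.007 R A v) s.1 s.2 x y ≤
          ∑ x ∈ T, (0.12 + if x ∈ s.1 then 1 else 0) := by
        refine Finset.sum_le_sum fun x hx => ?_
        have := (charge_le_of_notMem (G := G) ha (hT hx) hyC).1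
        rwa [if_pos h] at this
      rw [Finset.sum_add_distrib, Finset.sum_const, Finset.sum_boole, nsmul_eq_mul] at h1
      have h2 : ((T.filter fun x => x ∈ s.1).card : ℝ) ≤ sampleSize G 0.179 R v := by
        have : (T.filter fun x => x ∈ s.1) ⊆ s.1 := fun x hx => (Finset.mem_filter.mp hx).2
        exact_mod_cast (Finset.card_le_card this).trans (mem_support_sampleLaw hs).1.2
      have h3 := sampleSize_le (G := G) (R := R) (v := v) 0.179 (by norm_num)
      rw [if_pos h]
      linarith
    · rw [if_neg h, zero_mul, sub_zero, mul_comm, ← nsmul_eq_mul]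
      exact Finset.sum_le_card_nsmul _ _ _ fun x hx => (charge_le_of_notMem (G := G) ha (hT hx) hyC).2
  have h := expect_mono _ key
  rw [expect_sum, expect_sub, expect_const, expect_mul_const] at h
  rwa [expect_sampleLaw_snd G 0.007 0.179 R A v fun T => if y ∈ T then 1 else 0] at h

/-- The size 112 absorbs the rounding in the sample size, as `0.009 · 112 > 1`. -/
theorem le_removalProb (hx : x ∈ setD G 0.179 R v) (hn : 112 ≤ ((setC G R v).card : ℝ)) :
    0.17 ≤ removalProb G R v x := by
  refine le_expect_mem_uniformSubset hx (by norm_num) ?_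
  have h1 : ((setD G 0.179 R v).card : ℝ) ≤ (setC G R v).card := by
    exact_mod_cast Finset.card_le_card setD_subset_setC
  have h2 := lt_sampleSize (G := G) (R := R) (v := v) 0.179
  linarith

/-- Here `0.027 · 6.5 = 0.179 - 0.0035`, and `hn` says precisely that `0.0035 |C_v|` absorbs the
rounding loss of 1. -/
theorem le_joinProb (hx : x ∈ setA G 0.007 R A v) (hn : 2 ≤ 0.007 * ((setC G R v).card : ℝ))
    (hF : ((setA G 0.007 R A v).card : ℝ) ≤ 6.5 * (setC G R v).card) :
    0.027 ≤ joinProb G R A v x := by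
  refine le_expect_mem_uniformSubset hx (by norm_num) ?_
  have h2 := lt_sampleSize (G := G) (R := R) (v := v) 0.179
  linarith

omit [Fintype V] in
theorem mem_setC_comm {a b : V} (ha : a ∈ R) (hb : b ∈ R) : a ∈ setC G R b ↔ b ∈ setC G R a := by
  simp only [mem_setC, ha, hb, true_and, G.adj_comm a b, eq_comm (a := a)]

/-- The total expected charge to the triangle `a b x`. -/
def triangleCharge (G : SimpleGraph V) [DecidableRel G.Adj] (R A : Finset V) (a b x : V) : ℝ :=
  meanCharge G R A a b x + meanCharge G R A b a x + meanCharge G R A x a b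

theorem triangleCharge_comm (a b x : V) :
    triangleCharge G R A a b x = triangleCharge G R A b a x := by
  rw [triangleCharge, triangleCharge, meanCharge_comm G R A x a b]
  ring

/-! ### Core estimate for edges. -/

variable {a b : V}

/-- The centre `a` as pivot sees both other vertices, which gives the saving from removing `b`; the
pivots `b` and `x` contribute `1.0071` each. -/
theorem triangleCharge_le_of_adj (ha : a ∈ R) (hb : b ∈ R) (hab : G.Adj a b) (hx : x ∈ R)
    (hxa : x ∈ setC G R a) (hxb : x ∉ setC G R b) :
    triangleCharge G R A a b x ≤ 3.0142 - 0.5638 * removalProb G R a b := by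
  have h1 : b ∈ setC G R a := mem_setC.mpr (Or.inr ⟨hb, hab⟩)
  have h2 : a ∈ setC G R b := mem_setC.mpr (Or.inr ⟨ha, hab.symm⟩)
  have e1 := meanCharge_le_of_mem (A := A) h1 hxa
  have e2 := meanCharge_le_of_notMem (A := A) h2 hxb
  have e3 := meanCharge_le_of_notMem (A := A) ((mem_setC_comm hx ha).mp hxa)
    (fun h => hxb ((mem_setC_comm hb hx).mp h))
  rw [triangleCharge]
  linarith

theorem triangleCharge_eq_zero_of_adj (ha : a ∈ R) (hb : b ∈ R) (hab : G.Adj a b) (hx : x ∈ R)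
    (hxab : x ∈ setC G R a ↔ x ∈ setC G R b) : triangleCharge G R A a b x = 0 := by
  have h1 : b ∈ setC G R a := mem_setC.mpr (Or.inr ⟨hb, hab⟩)
  have h2 : a ∈ setC G R b := mem_setC.mpr (Or.inr ⟨ha, hab.symm⟩)
  by_cases h : x ∈ setC G R a
  · have h' := hxab.mp h
    have e3 : meanCharge G R A x a b = 0 := meanCharge_eq_zero_of_adj
      ((mem_setC_comm hx ha).mp h) ((mem_setC_comm hx hb).mp h') hab
    rw [triangleCharge, e3]
    rcases mem_setC.mp h with rfl | ⟨-, hax⟩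
    · rw [meanCharge_self, meanCharge_eq_zero_of_adj h1 h hab.symm]
      norm_num
    · rcases mem_setC.mp h' with rfl | ⟨-, hbx⟩
      · rw [meanCharge_self, meanCharge_eq_zero_of_adj h2 h' hab]
        norm_num
      · rw [meanCharge_eq_zero_of_adj h1 h hbx, meanCharge_eq_zero_of_adj h2 h' hax]
        norm_num
  · have h' := fun t => h (hxab.mpr t)
    have n1 : ¬ G.Adj b x := fun t => h' (mem_setC.mpr (Or.inr ⟨hx, t⟩))
    have n2 : ¬ G.Adj a x := fun t => h (mem_setC.mpr (Or.inr ⟨hx, t⟩))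
    rw [triangleCharge, meanCharge_eq_zero_of_not_adj h n1, meanCharge_eq_zero_of_not_adj h' n2,
      meanCharge_eq_zero_of_notMem (fun t => h ((mem_setC_comm hx ha).mpr t))
        (fun t => h' ((mem_setC_comm hx hb).mpr t))]
    norm_num

theorem sum_triangleCharge_le_of_adj_of_card_le (ha : a ∈ R) (hb : b ∈ R) (hab : G.Adj a b)
    (hle : (setC G R b \ setC G R a).card ≤ (setC G R a \ setC G R b).card) :
    ∑ x ∈ R, triangleCharge G R A a b x ≤ 2.997 * (setC G R a ∪ setC G R b).card := by
  have h1 : b ∈ setC G R a := mem_setC.mpr (Or.inr ⟨hb, hab⟩)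
  have h2 : a ∈ setC G R b := mem_setC.mpr (Or.inr ⟨ha, hab.symm⟩)
  have hsum : ∑ x ∈ R, triangleCharge G R A a b x ≤
      (setC G R a \ setC G R b).card * (3.0142 - 0.5638 * removalProb G R a b) +
        (setC G R b \ setC G R a).card * 3.0142 := by
    have hRa := setC_subset (G := G) ha
    have hRb := setC_subset (G := G) hb
    rw [← Finset.sum_subset (s₁ := (setC G R a \ setC G R b) ∪ (setC G R b \ setC G R a))
      (Finset.union_subset (Finset.sdiff_subset.trans hRa) (Finset.sdiff_subset.trans hRb)),
      Finset.sum_union disjoint_sdiff_sdiff, ← nsmul_eq_mul, ← nsmul_eq_mul]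
    · refine add_le_add (Finset.sum_le_card_nsmul _ _ _ fun x hx => ?_)
        (Finset.sum_le_card_nsmul _ _ _ fun x hx => ?_)
      · rw [Finset.mem_sdiff] at hx
        exact triangleCharge_le_of_adj ha hb hab (hRa hx.1) hx.1 hx.2
      · rw [Finset.mem_sdiff] at hx
        rw [triangleCharge_comm]
        have := triangleCharge_le_of_adj (A := A) hb ha hab.symm (hRb hx.1) hx.1 hx.2
        linarith [removalProb_nonneg G R b a]
    · intro x hx hx'
      refine triangleCharge_eq_zero_of_adj ha hb hab hx ?_
      simp only [Finset.mem_union, Finset.mem_sdiff] at hx'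
      tauto
  have cU : ((setC G R a ∪ setC G R b).card : ℝ) = (setC G R a \ setC G R b).card +
      (setC G R b \ setC G R a).card + (setC G R a ∩ setC G R b).card := by
    have e1 := Finset.card_union_add_card_inter (setC G R a) (setC G R b)
    have e2 := Finset.card_sdiff_add_card_inter (setC G R a) (setC G R b)
    have e3 := Finset.card_sdiff_add_card_inter (setC G R b) (setC G R a)
    rw [Finset.inter_comm] at e3
    have : (setC G R a ∪ setC G R b).card = (setC G R a \ setC G R b).card +
      (setC G R b \ setC G R a).card + (setC G R a ∩ setC G R b).card := by omega
    exact_mod_cast this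
  have ca : ((setC G R a).card : ℝ) =
      (setC G R a \ setC G R b).card + (setC G R a ∩ setC G R b).card := by
    exact_mod_cast (Finset.card_sdiff_add_card_inter (setC G R a) (setC G R b)).symm
  have cI : (2 : ℝ) ≤ (setC G R a ∩ setC G R b).card := by
    have : ({a, b} : Finset V) ⊆ setC G R a ∩ setC G R b := by
      intro z hz
      rw [Finset.mem_insert, Finset.mem_singleton] at hz
      rw [Finset.mem_inter]
      rcases hz with rfl | rfl
      · exact ⟨mem_setC.mpr (Or.inl rfl), h2⟩
      · exact ⟨h1, mem_setC.mpr (Or.inl rfl)⟩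
    have := Finset.card_le_card this
    rw [Finset.card_pair hab.ne] at this
    exact_mod_cast this
  have cN : ((nbr G R b ∩ setC G R a).card : ℝ) = (setC G R a ∩ setC G R b).card - 1 := by
    have hbn : b ∉ nbr G R b ∩ setC G R a := by simp [mem_nbr]
    have : setC G R a ∩ setC G R b = insert b (nbr G R b ∩ setC G R a) := by
      ext z
      rw [Finset.mem_insert, Finset.mem_inter, Finset.mem_inter, mem_setC (v := b), mem_nbr]
      constructor
      · tauto
      · rintro (rfl | h)
        · exact ⟨h1, Or.inl rfl⟩
        · tauto
    rw [this, Finset.card_insert_of_notMem hbn]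
    push_cast; ring
  have hle' : ((setC G R b \ setC G R a).card : ℝ) ≤ (setC G R a \ setC G R b).card := by
    exact_mod_cast hle
  have hα : (0 : ℝ) ≤ (setC G R a \ setC G R b).card := by positivity
  have hp := removalProb_nonneg G R a b
  have hαp := mul_nonneg hα hp
  -- With a large intersection the slack suffices, as `3.0142 < 2.997 · 1.0058`.
  by_cases hI : 0.0058 * (((setC G R a \ setC G R b).card : ℝ) +
      (setC G R b \ setC G R a).card) ≤ (setC G R a ∩ setC G R b).card
  · rw [cU]
    linarith
  · push Not at hI
    have hD : b ∈ setD G 0.179 R a := by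
      rw [setD, Finset.mem_filter, mem_nbr]
      refine ⟨⟨hb, hab⟩, ?_⟩
      rw [cN, ca]
      linarith
    -- The intersection contains `a` and `b`, so being relatively small it forces `C_a` to be large.
    -- The saving `0.17 · 0.5638` applies to at least half of the symmetric difference, because `C_a
    -- \ C_b` is the larger side.
    have hpr := le_removalProb hD (by rw [ca]; linarith)
    have := mul_le_mul_of_nonneg_left hpr hα
    rw [cU]
    linarith

/-! ### Core estimate for non-edges; only common neighbours matter. -/

theorem triangleCharge_eq_zero_of_not_adj (hab : a ≠ b) (hnab : ¬ G.Adj a b) (hx : x ∈ R)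
    (hxab : x ∉ nbr G R a ∩ nbr G R b) : triangleCharge G R A a b x = 0 := by
  have n1 : b ∉ setC G R a := by rw [mem_setC]; tauto
  have n2 : a ∉ setC G R b := by rw [mem_setC, G.adj_comm]; tauto
  have hn : ¬ (G.Adj a x ∧ G.Adj b x) := by
    rw [Finset.mem_inter, mem_nbr, mem_nbr] at hxab
    tauto
  have e1 : meanCharge G R A a b x = 0 := by
    by_cases h : x ∈ setC G R a
    · rw [meanCharge_comm]
      refine meanCharge_eq_zero_of_not_adj n1 fun t => ?_
      rcases mem_setC.mp h with rfl | h
      · exact hnab t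
      · exact hn ⟨h.2, t.symm⟩
    · exact meanCharge_eq_zero_of_notMem n1 h
  have e2 : meanCharge G R A b a x = 0 := by
    by_cases h : x ∈ setC G R b
    · rw [meanCharge_comm]
      refine meanCharge_eq_zero_of_not_adj n2 fun t => ?_
      rcases mem_setC.mp h with rfl | h
      · exact hnab t.symm
      · exact hn ⟨t.symm, h.2⟩
    · exact meanCharge_eq_zero_of_notMem n2 h
  have e3 : meanCharge G R A x a b = 0 := by
    by_cases h : a ∈ setC G R x
    · by_cases h' : b ∈ setC G R x
      · rw [mem_setC] at h h'
        rcases h with rfl | h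
        · rcases h' with rfl | h'
          · exact meanCharge_self
          · exact absurd h'.2 hnab
        · rcases h' with rfl | h'
          · exact absurd h.2.symm hnab
          · exact absurd ⟨h.2.symm, h'.2.symm⟩ hn
      · exact meanCharge_eq_zero_of_not_adj h' hnab
    · rw [meanCharge_comm]
      exact meanCharge_eq_zero_of_not_adj h fun t => hnab t.symm
  rw [triangleCharge, e1, e2, e3]
  norm_num

omit [Fintype V] in
theorem card_setC_add_card_setC (hab : a ≠ b) (hnab : ¬ G.Adj a b) :
    ((setC G R a).card : ℝ) + (setC G R b).card =
      (setC G R a ∪ setC G R b).card + (nbr G R a ∩ nbr G R b).card := by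
  have : setC G R a ∩ setC G R b = nbr G R a ∩ nbr G R b := by
    ext z
    simp only [Finset.mem_inter, mem_setC, mem_nbr]
    constructor
    · rintro ⟨rfl | h, rfl | h'⟩
      · exact absurd rfl hab
      · exact absurd h'.2.symm hnab
      · exact absurd h.2 hnab
      · exact ⟨h, h'⟩
    · tauto
  rw [← this]
  exact_mod_cast (Finset.card_union_add_card_inter (setC G R a) (setC G R b)).symm

omit [Fintype V] in
theorem card_symmDiff_nbr_setC (hab : a ≠ b) (hnab : ¬ G.Adj a b) :
    ((symmDiff (nbr G R b) (setC G R a)).card : ℝ) =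
      (setC G R a ∪ setC G R b).card - (nbr G R a ∩ nbr G R b).card - 1 := by
  have hb : b ∉ symmDiff (nbr G R b) (setC G R a) ∪ (nbr G R a ∩ nbr G R b) := by
    simp only [Finset.mem_union, Finset.mem_symmDiff, Finset.mem_inter, mem_nbr, mem_setC,
      G.irrefl]
    tauto
  have h1 : setC G R a ∪ setC G R b =
      insert b (symmDiff (nbr G R b) (setC G R a) ∪ (nbr G R a ∩ nbr G R b)) := by
    ext z
    simp only [Finset.mem_union, Finset.mem_insert, Finset.mem_symmDiff, Finset.mem_inter,
      mem_nbr, mem_setC]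
    by_cases hz : z = a
    · subst hz
      have : ¬ G.Adj b z := fun h => hnab h.symm
      tauto
    · tauto
  have hd : Disjoint (symmDiff (nbr G R b) (setC G R a)) (nbr G R a ∩ nbr G R b) := by
    rw [Finset.disjoint_left]
    intro z
    simp only [Finset.mem_symmDiff, Finset.mem_inter, mem_nbr, mem_setC]
    tauto
  rw [h1, Finset.card_insert_of_notMem hb, Finset.card_union_of_disjoint hd]
  push_cast; ring

omit [Fintype V] in
theorem card_nbr_inter_add_two_le (R : Finset V) (hab : a ≠ b) :
    ((nbr G R a ∩ nbr G R b).card : ℝ) + 2 ≤ (setC G R a ∪ setC G R b).card := by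
  have h : insert a (insert b (nbr G R a ∩ nbr G R b)) ⊆ setC G R a ∪ setC G R b := by
    intro z
    simp only [Finset.mem_union, Finset.mem_insert, Finset.mem_inter, mem_nbr, mem_setC]
    tauto
  have := Finset.card_le_card h
  rw [Finset.card_insert_of_notMem, Finset.card_insert_of_notMem] at this
  · exact_mod_cast this
  · simp [mem_nbr]
  · simp [mem_nbr, hab]

theorem sum_triangleCharge_eq (hab : a ≠ b) (hnab : ¬ G.Adj a b) :
    ∑ x ∈ R, triangleCharge G R A a b x =
      ∑ x ∈ nbr G R a ∩ nbr G R b, meanCharge G R A a x b +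
        ∑ x ∈ nbr G R a ∩ nbr G R b, meanCharge G R A b x a +
        ∑ x ∈ nbr G R a ∩ nbr G R b, meanCharge G R A x a b := by
  rw [← Finset.sum_subset (Finset.inter_subset_left.trans (Finset.filter_subset _ _)) fun x hx hx' =>
    triangleCharge_eq_zero_of_not_adj hab hnab hx hx', ← Finset.sum_add_distrib,
    ← Finset.sum_add_distrib]
  refine Finset.sum_congr rfl fun x _ => ?_
  rw [triangleCharge, meanCharge_comm G R A a, meanCharge_comm G R A b]

theorem meanCharge_le_of_mem_nbr_inter (ha : a ∈ R) (hb : b ∈ R)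
    (hx : x ∈ nbr G R a ∩ nbr G R b) :
    meanCharge G R A x a b ≤ 1 - 0.5638 * removalProb G R x a := by
  simp only [Finset.mem_inter, mem_nbr] at hx
  exact meanCharge_le_of_mem (mem_setC.mpr (Or.inr ⟨ha, hx.1.2.symm⟩))
    (mem_setC.mpr (Or.inr ⟨hb, hx.2.2.symm⟩))

theorem sum_triangleCharge_le_of_notMem_setA (ha : a ∈ R) (hb : b ∈ R) (hab : a ≠ b)
    (hnab : ¬ G.Adj a b) (hFa : b ∉ setA G 0.007 R A a) (hFb : a ∉ setA G 0.007 R A b) :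
    ∑ x ∈ R, triangleCharge G R A a b x ≤ 2.997 * (setC G R a ∪ setC G R b).card := by
  have n1 : b ∉ setC G R a := by rw [mem_setC]; tauto
  have n2 : a ∉ setC G R b := by rw [mem_setC, G.adj_comm]; tauto
  have hTa : ∀ x ∈ nbr G R a ∩ nbr G R b, x ∈ setC G R a := fun x hx =>
    Finset.mem_insert_of_mem (Finset.mem_inter.mp hx).1
  have hTb : ∀ x ∈ nbr G R a ∩ nbr G R b, x ∈ setC G R b := fun x hx =>
    Finset.mem_insert_of_mem (Finset.mem_inter.mp hx).2
  have hT := card_nbr_inter_add_two_le (G := G) R hab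
  have hT0 : (0 : ℝ) ≤ (nbr G R a ∩ nbr G R b).card := by positivity
  have s1 : ∑ x ∈ nbr G R a ∩ nbr G R b, meanCharge G R A a x b ≤
      (nbr G R a ∩ nbr G R b).card * if b ∈ A then 0 else 1 := by
    rw [← nsmul_eq_mul]
    exact Finset.sum_le_card_nsmul _ _ _ fun x hx =>
      meanCharge_le_of_notMem_setA (hTa x hx) n1 hFa
  have s2 : ∑ x ∈ nbr G R a ∩ nbr G R b, meanCharge G R A b x a ≤
      (nbr G R a ∩ nbr G R b).card * if a ∈ A then 0 else 1 := by
    rw [← nsmul_eq_mul]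
    exact Finset.sum_le_card_nsmul _ _ _ fun x hx =>
      meanCharge_le_of_notMem_setA (hTb x hx) n2 hFb
  have s3 : ∑ x ∈ nbr G R a ∩ nbr G R b, meanCharge G R A x a b ≤
      (nbr G R a ∩ nbr G R b).card * 1 := by
    rw [← nsmul_eq_mul]
    refine Finset.sum_le_card_nsmul _ _ _ fun x hx => ?_
    have := meanCharge_le_of_mem_nbr_inter (A := A) ha hb hx
    linarith [removalProb_nonneg G R x a]
  rw [sum_triangleCharge_eq hab hnab]
  -- If an endpoint is already clustered, one of the three pivots contributes nothing and the total
  -- is at most twice the number of common neighbours.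
  by_cases hbA : b ∈ A
  · rw [if_pos hbA] at s1
    split_ifs at s2 <;> linarith
  by_cases haA : a ∈ A
  · rw [if_pos haA] at s2
    rw [if_neg hbA] at s1
    linarith
  rw [if_neg haA] at s2
  rw [if_neg hbA] at s1
  -- Neither endpoint is in `A`, so they fail to be candidates only because the symmetric
  -- differences are large.
  have d1 : 0.007 * ((setC G R a).card : ℝ) - 1 <
      (setC G R a ∪ setC G R b).card - (nbr G R a ∩ nbr G R b).card - 1 := by
    rw [← card_symmDiff_nbr_setC hab hnab]
    by_contra! h
    exact hFa (mem_setA.mpr ⟨⟨hb, n1⟩, hbA, h⟩)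
  have d2 : 0.007 * ((setC G R b).card : ℝ) - 1 <
      (setC G R a ∪ setC G R b).card - (nbr G R a ∩ nbr G R b).card - 1 := by
    rw [Finset.union_comm, Finset.inter_comm,
      ← card_symmDiff_nbr_setC hab.symm fun h => hnab h.symm]
    by_contra! h
    exact hFb (mem_setA.mpr ⟨⟨ha, n2⟩, haA, h⟩)
  have d3 := card_setC_add_card_setC (R := R) hab hnab
  linarith

omit [Fintype V] in
/-- Few members of the neighbourhood of a pivot have many non-neighbours among the candidates for
joining its cluster. -/
theorem card_filter_nonadjacent_le (hv : v ∈ R) (hF : (setA G 0.007 R A v).Nonempty) :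
    (((setC G R v).filter fun x => 0.1 * ((setA G 0.007 R A v).card : ℝ) <
      ((setA G 0.007 R A v).filter fun w => ¬ G.Adj x w).card).card : ℝ) ≤
      0.07 * (setC G R v).card := by
  have hCR := setC_subset (G := G) hv
  set F := setA G 0.007 R A v with hFdef
  set C := setC G R v with hC
  set B := C.filter fun x => 0.1 * (F.card : ℝ) < (F.filter fun w => ¬ G.Adj x w).card with hB
  have hFpos : (0 : ℝ) < F.card := by exact_mod_cast hF.card_pos
  -- Double counting of the non-adjacent pairs between `C` and `F`: each candidate is in at most
  -- `0.007 |C|` of them, each member of `B` in more than `0.1 |F|`.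
  have h1 : (B.card : ℝ) * (0.1 * F.card) ≤
      ∑ x ∈ C, ((F.filter fun w => ¬ G.Adj x w).card : ℝ) := by
    rw [← nsmul_eq_mul]
    refine (Finset.card_nsmul_le_sum B _ _ fun x hx => (Finset.mem_filter.mp hx).2.le).trans ?_
    exact Finset.sum_le_sum_of_subset_of_nonneg (Finset.filter_subset _ _)
      fun _ _ _ => by positivity
  have h2 : ∑ x ∈ C, ((F.filter fun w => ¬ G.Adj x w).card : ℝ) =
      ∑ w ∈ F, ((C.filter fun x => ¬ G.Adj x w).card : ℝ) := by
    simp only [← Finset.sum_boole]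
    exact Finset.sum_comm
  have h3 : ∑ w ∈ F, ((C.filter fun x => ¬ G.Adj x w).card : ℝ) ≤
      F.card • (0.007 * (C.card : ℝ)) := by
    refine Finset.sum_le_card_nsmul _ _ _ fun w hw => ?_
    have h4 := (mem_setA.mp hw).2.2
    have h5 : (C.filter fun x => ¬ G.Adj x w) ⊆ symmDiff (nbr G R w) C := by
      intro x hx
      rw [Finset.mem_filter] at hx
      rw [Finset.mem_symmDiff, mem_nbr, G.adj_comm]
      tauto
    have h6 : ((C.filter fun x => ¬ G.Adj x w).card : ℝ) ≤ (symmDiff (nbr G R w) C).card := by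
      exact_mod_cast Finset.card_le_card h5
    linarith
  rw [nsmul_eq_mul] at h3
  have h7 : (F.card : ℝ) * B.card ≤ F.card * (0.07 * C.card) := by linarith
  exact le_of_mul_le_mul_left h7 hFpos

theorem sum_triangleCharge_le_of_mem_setA (ha : a ∈ R) (hab : a ≠ b)
    (hnab : ¬ G.Adj a b) (hF : b ∈ setA G 0.007 R A a) :
    ∑ x ∈ R, triangleCharge G R A a b x ≤ 2.997 * (setC G R a ∪ setC G R b).card := by
  have hb : b ∈ R := (mem_setA.mp hF).1.1
  have n2 : a ∉ setC G R b := by rw [mem_setC, G.adj_comm]; tauto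
  have hTa : nbr G R a ∩ nbr G R b ⊆ setC G R a := fun x hx =>
    Finset.mem_insert_of_mem (Finset.mem_inter.mp hx).1
  have hTb : nbr G R a ∩ nbr G R b ⊆ setC G R b := fun x hx =>
    Finset.mem_insert_of_mem (Finset.mem_inter.mp hx).2
  have hT := card_nbr_inter_add_two_le (G := G) R hab
  have hs := (mem_setA.mp hF).2.2
  rw [card_symmDiff_nbr_setC hab hnab] at hs
  have hU : ((setC G R a).card : ℝ) ≤ (setC G R a ∪ setC G R b).card := by
    exact_mod_cast Finset.card_le_card Finset.subset_union_left
  have s1 := sum_meanCharge_le_of_mem_setA (A := A) hTa hF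
  have s2 : ∑ x ∈ nbr G R a ∩ nbr G R b, meanCharge G R A b x a ≤
      (nbr G R a ∩ nbr G R b).card * 1.0071 := by
    rw [← nsmul_eq_mul]
    exact Finset.sum_le_card_nsmul _ _ _ fun x hx => meanCharge_le_of_notMem (hTb hx) n2
  have hq : 0 ≤ joinProb G R A a b := expect_nonneg _ fun _ _ => by positivity
  have hgain : 0 ≤ 0.8871 * ((nbr G R a ∩ nbr G R b).card : ℝ) - 0.179 * (setC G R a).card := by
    linarith
  rw [sum_triangleCharge_eq hab hnab]
  by_cases hsmall : ((setA G 0.007 R A a).card : ℝ) ≤ 6.5 * (setC G R a).card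
  · have s3 : ∑ x ∈ nbr G R a ∩ nbr G R b, meanCharge G R A x a b ≤
        (nbr G R a ∩ nbr G R b).card * 1 := by
      rw [← nsmul_eq_mul]
      refine Finset.sum_le_card_nsmul _ _ _ fun x hx => ?_
      have := meanCharge_le_of_mem_nbr_inter (A := A) ha hb hx
      linarith [removalProb_nonneg G R x a]
    -- The union exceeds the common neighbourhood by at least 2, while candidacy bounds the excess
    -- by `0.007 |C_a|`; this is the required size bound.
    have hq' := le_joinProb hF (by linarith) hsmall
    have := mul_le_mul_of_nonneg_right hq' hgain
    linarith
  · push Not at hsmall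
    have hqg := mul_nonneg hq hgain
    set T := nbr G R a ∩ nbr G R b with hTdef
    set F := setA G 0.007 R A a with hFdef
    set B := T.filter fun x => 0.1 * (F.card : ℝ) < (F.filter fun w => ¬ G.Adj x w).card with hB
    have hBc : (B.card : ℝ) ≤ 0.07 * (setC G R a).card := by
      refine le_trans ?_ (card_filter_nonadjacent_le ha ⟨b, hF⟩)
      exact_mod_cast Finset.card_le_card (Finset.filter_subset_filter _ hTa)
    -- Outside `B`, the vertex `x` has at least `0.9 · 6.5 |C_a|` neighbours, and `0.179 · 5.85 > 1`
    -- puts `a` in `D_x`. Then `1 - 0.5638 · 0.17 < 0.9042`.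
    have s3 : ∑ x ∈ T, meanCharge G R A x a b ≤ ∑ x ∈ T, (0.9042 + if x ∈ B then 0.0958 else 0) := by
      refine Finset.sum_le_sum fun x hx => ?_
      have hm := meanCharge_le_of_mem_nbr_inter (A := A) ha hb hx
      split_ifs with hxB
      · linarith [removalProb_nonneg G R x a]
      · have hx' : ((F.filter fun w => ¬ G.Adj x w).card : ℝ) ≤ 0.1 * F.card := by
          by_contra! h
          exact hxB (Finset.mem_filter.mpr ⟨hx, h⟩)
        have c1 : ((F.filter fun w => G.Adj x w).card : ℝ) +
            (F.filter fun w => ¬ G.Adj x w).card = F.card := by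
          exact_mod_cast Finset.card_filter_add_card_filter_not (s := F) fun w => G.Adj x w
        have c2 : ((F.filter fun w => G.Adj x w).card : ℝ) ≤ (setC G R x).card := by
          have : (F.filter fun w => G.Adj x w) ⊆ setC G R x := by
            intro w hw
            rw [Finset.mem_filter] at hw
            exact mem_setC.mpr (Or.inr ⟨(mem_setA.mp hw.1).1.1, hw.2⟩)
          exact_mod_cast Finset.card_le_card this
        have c3 : ((nbr G R a ∩ setC G R x).card : ℝ) ≤ (setC G R a).card - 1 := by
          have h1 : (nbr G R a ∩ setC G R x).card ≤ (nbr G R a).card :=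
            Finset.card_le_card Finset.inter_subset_left
          have h2 : (setC G R a).card = (nbr G R a).card + 1 :=
            Finset.card_insert_of_notMem (by simp [mem_nbr])
          have h3 : (nbr G R a ∩ setC G R x).card + 1 ≤ (setC G R a).card := by omega
          have h4 : ((nbr G R a ∩ setC G R x).card : ℝ) + 1 ≤ (setC G R a).card := by
            exact_mod_cast h3
          linarith
        have hD : a ∈ setD G 0.179 R x := by
          rw [setD, Finset.mem_filter, mem_nbr]
          have hxa := (Finset.mem_filter.mp (Finset.mem_inter.mp hx).1).2
          exact ⟨⟨ha, hxa.symm⟩, by linarith⟩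
        have := le_removalProb hD (by linarith)
        linarith
    have s4 : ∑ x ∈ T, (if x ∈ B then (0.0958 : ℝ) else 0) = B.card * 0.0958 := by
      rw [← nsmul_eq_mul, ← Finset.sum_const, ← Finset.sum_filter]
      congr 1
      ext x
      simp only [hB, Finset.mem_filter]
      tauto
    rw [Finset.sum_add_distrib, s4, Finset.sum_const, nsmul_eq_mul] at s3
    linarith

theorem sum_triangleCharge_le (ha : a ∈ R) (hb : b ∈ R) (hab : a ≠ b) :
    ∑ x ∈ R, triangleCharge G R A a b x ≤ 2.997 * (setC G R a ∪ setC G R b).card := by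
  by_cases hE : G.Adj a b
  · rcases le_total (setC G R b \ setC G R a).card (setC G R a \ setC G R b).card with h | h
    · exact sum_triangleCharge_le_of_adj_of_card_le ha hb hE h
    · simp only [triangleCharge_comm a b]
      rw [Finset.union_comm]
      exact sum_triangleCharge_le_of_adj_of_card_le hb ha hE.symm h
  · by_cases h1 : b ∈ setA G 0.007 R A a
    · exact sum_triangleCharge_le_of_mem_setA ha hab hE h1
    · by_cases h2 : a ∈ setA G 0.007 R A b
      · simp only [triangleCharge_comm a b]
        rw [Finset.union_comm]
        exact sum_triangleCharge_le_of_mem_setA hb hab.symm (fun h => hE h.symm) h2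
      · exact sum_triangleCharge_le_of_notMem_setA ha hb hab hE h1 h2

end PairSums

/-! ### Comparison with a fixed clustering, and induction. -/

noncomputable section Duality

variable {V : Type*} [DecidableEq V] [Fintype V] {G : SimpleGraph V} [DecidableRel G.Adj]
  {P : Finset (Finset V)} {R A : Finset V}

omit [DecidableEq V] [Fintype V] in
theorem IsClustering.joint_trans (hP : IsClustering P) {x y z : V} (hxy : Joint P x y)
    (hyz : Joint P y z) : Joint P x z := by
  obtain ⟨S, hS, hx, hy⟩ := hxy
  obtain ⟨T, hT, hy', hz⟩ := hyz
  have : S = T := (hP.2 y).unique ⟨hS, hy⟩ ⟨hT, hy'⟩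
  subst this
  exact ⟨S, hS, hx, hz⟩

omit [Fintype V] in
theorem pairCost_self (x : V) : pairCost G P x x = 0 := by
  simp [pairCost]

omit [Fintype V] in
/-- A clustering makes a mistake on every bad triangle. -/
theorem one_le_pairCost_triangle (hP : IsClustering P) {x y z : V} (hxy : G.Adj x y)
    (hyz : G.Adj y z) (hxz : ¬ G.Adj x z) (hne : x ≠ z) :
    1 ≤ pairCost G P x y + pairCost G P y z + pairCost G P x z := by
  have := @IsClustering.joint_trans V P hP x y z
  simp only [pairCost, hxy, hyz, hxz, hne, if_true, if_false]
  split_ifs <;> simp_all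

/-- A nonzero charge means a bad triangle, on which `P` errs at least once. -/
theorem meanCharge_le_mul_pairCost (hP : IsClustering P) {v x y : V} (hx : x ∈ R) (hy : y ∈ R) :
    meanCharge G R A v x y ≤ meanCharge G R A v x y *
      (pairCost G P v x + pairCost G P v y + pairCost G P x y) := by
  have h0 := meanCharge_nonneg G R A v x y
  by_cases hz : meanCharge G R A v x y = 0
  · rw [hz, zero_mul]
  refine le_mul_of_one_le_right h0 ?_
  by_cases hxC : x ∈ setC G R v <;> by_cases hyC : y ∈ setC G R v
  · have hne : x ≠ y := fun h => hz (h ▸ meanCharge_self)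
    have hE : ¬ G.Adj x y := fun h => hz (meanCharge_eq_zero_of_adj hxC hyC h)
    rcases mem_setC.mp hxC with rfl | hvx
    · rcases mem_setC.mp hyC with h | h
      · exact absurd h.symm hne
      · exact absurd h.2 hE
    · rcases mem_setC.mp hyC with rfl | hvy
      · exact absurd hvx.2.symm hE
      · have := one_le_pairCost_triangle hP hvx.2.symm hvy.2 hE hne
        rwa [pairCost_comm G P x v] at this
  · have hE : G.Adj x y := by_contra fun h => hz (meanCharge_eq_zero_of_not_adj hyC h)
    rw [mem_setC, not_or, not_and] at hyC
    rcases mem_setC.mp hxC with rfl | hvx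
    · exact absurd hE (hyC.2 hy)
    · have := one_le_pairCost_triangle hP hvx.2 hE (hyC.2 hy) (Ne.symm hyC.1)
      linarith
  · have hE : G.Adj y x := by_contra fun h => hz (by
      rw [meanCharge_comm]; exact meanCharge_eq_zero_of_not_adj hxC h)
    rw [mem_setC, not_or, not_and] at hxC
    rcases mem_setC.mp hyC with rfl | hvy
    · exact absurd hE (hxC.2 hx)
    · have := one_le_pairCost_triangle hP hvy.2 hE (hxC.2 hx) (Ne.symm hxC.1)
      rw [pairCost_comm G P x y]
      linarith
  · exact absurd (meanCharge_eq_zero_of_notMem hxC hyC) hz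

/-- The charges of one iteration are paid for by the mistakes of a clustering. -/
theorem sum_meanCharge_le (hP : IsClustering P) :
    ∑ v ∈ R, ∑ x ∈ R, ∑ y ∈ R, meanCharge G R A v x y ≤
      2.997 * ∑ a ∈ R, ∑ b ∈ R, pairCost G P a b * (setC G R a ∪ setC G R b).card := by
  have h1 : ∑ v ∈ R, ∑ x ∈ R, ∑ y ∈ R, meanCharge G R A v x y * pairCost G P v x =
      ∑ a ∈ R, ∑ b ∈ R, pairCost G P a b * ∑ x ∈ R, meanCharge G R A a b x :=
    Finset.sum_congr rfl fun v _ => Finset.sum_congr rfl fun x _ => by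
      rw [← Finset.sum_mul, mul_comm]
  have h2 : ∑ v ∈ R, ∑ x ∈ R, ∑ y ∈ R, meanCharge G R A v x y * pairCost G P v y =
      ∑ a ∈ R, ∑ b ∈ R, pairCost G P a b * ∑ x ∈ R, meanCharge G R A b a x := by
    rw [Finset.sum_comm (s := R) (t := R) (f := fun a b =>
      pairCost G P a b * ∑ x ∈ R, meanCharge G R A b a x)]
    refine Finset.sum_congr rfl fun v _ => ?_
    rw [Finset.sum_comm]
    refine Finset.sum_congr rfl fun y _ => ?_
    rw [← Finset.sum_mul, mul_comm, pairCost_comm]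
    exact congrArg _ (Finset.sum_congr rfl fun x _ => meanCharge_comm ..)
  have h3 : ∑ v ∈ R, ∑ x ∈ R, ∑ y ∈ R, meanCharge G R A v x y * pairCost G P x y =
      ∑ a ∈ R, ∑ b ∈ R, pairCost G P a b * ∑ x ∈ R, meanCharge G R A x a b := by
    rw [Finset.sum_comm]
    refine Finset.sum_congr rfl fun x _ => ?_
    rw [Finset.sum_comm]
    exact Finset.sum_congr rfl fun y _ => by rw [← Finset.sum_mul, mul_comm]
  calc _ ≤ ∑ v ∈ R, ∑ x ∈ R, ∑ y ∈ R, meanCharge G R A v x y *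
        (pairCost G P v x + pairCost G P v y + pairCost G P x y) :=
        Finset.sum_le_sum fun v _ => Finset.sum_le_sum fun x hx => Finset.sum_le_sum fun y hy =>
          meanCharge_le_mul_pairCost hP hx hy
    _ = ∑ a ∈ R, ∑ b ∈ R, pairCost G P a b * ∑ x ∈ R, triangleCharge G R A a b x := by
        simp only [mul_add, triangleCharge, Finset.sum_add_distrib, h1, h2, h3]
    _ ≤ ∑ a ∈ R, ∑ b ∈ R, pairCost G P a b * (2.997 * (setC G R a ∪ setC G R b).card) := by
        refine Finset.sum_le_sum fun a ha => Finset.sum_le_sum fun b hb => ?_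
        by_cases hab : a = b
        · subst hab
          rw [pairCost_self, zero_mul, zero_mul]
        · exact mul_le_mul_of_nonneg_left (sum_triangleCharge_le ha hb hab)
            (pairCost_nonneg ..)
    _ = _ := by
        simp only [Finset.mul_sum]
        exact Finset.sum_congr rfl fun a _ => Finset.sum_congr rfl fun b _ => by ring

-- By symmetry of adjacency, the pair `(a, b)` drops out after pivot `v` exactly when `v ∈ C_a ∪
-- C_b`.
omit [Fintype V] in
theorem sum_costOn_sub (R : Finset V) :
    ∑ v ∈ R, (costOn G P R - costOn G P (R \ setC G R v)) =
      ∑ a ∈ R, ∑ b ∈ R, pairCost G P a b * (setC G R a ∪ setC G R b).card := by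
  have h : ∀ v ∈ R, costOn G P R - costOn G P (R \ setC G R v) =
      ∑ a ∈ R, ∑ b ∈ R, pairCost G P a b * if v ∈ setC G R a ∪ setC G R b then 1 else 0 := by
    intro v hv
    have h1 : costOn G P (R \ setC G R v) = ∑ a ∈ R, ∑ b ∈ R,
        if a ∉ setC G R v ∧ b ∉ setC G R v then pairCost G P a b else 0 := by
      simp only [costOn, Finset.sdiff_eq_filter, Finset.sum_filter, ite_and]
      refine Finset.sum_congr rfl fun a _ => ?_
      split_ifs <;> simp
    rw [h1, costOn, ← Finset.sum_sub_distrib]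
    refine Finset.sum_congr rfl fun a ha => ?_
    rw [← Finset.sum_sub_distrib]
    refine Finset.sum_congr rfl fun b hb => ?_
    simp only [Finset.mem_union, mem_setC_comm hv ha, mem_setC_comm hv hb]
    by_cases p : a ∈ setC G R v <;> by_cases q : b ∈ setC G R v <;> simp [p, q]
  rw [Finset.sum_congr rfl h, Finset.sum_comm]
  refine Finset.sum_congr rfl fun a ha => ?_
  rw [Finset.sum_comm]
  refine Finset.sum_congr rfl fun b hb => ?_
  rw [← Finset.mul_sum, Finset.sum_boole, Finset.filter_mem_eq_inter, Finset.inter_eq_right.mpr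
    (Finset.union_subset (setC_subset ha) (setC_subset hb))]

/-- The expected cost of the loop is at most `2.997` times the cost of a clustering on `R`. -/
theorem expect_costOn_loop_le (hP : IsClustering P) (R A : Finset V) :
    expect (modifiedPivotLoop G 0.007 0.179 R A) (fun Q => costOn G Q (R \ A)) ≤
      2.997 * costOn G P R := by
  induction h : R.card using Nat.strong_induction_on generalizing R A with
  | _ n ih =>
    subst h
    by_cases hR : R.Nonempty
    · have hstep : ∀ v : {v : V // v ∈ R},
          (expect (sampleLaw G 0.007 0.179 R A v.1) fun s =>
            expect (modifiedPivotLoop G 0.007 0.179 (R \ setC G R v.1)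
              (A ∪ setA G 0.007 R A v.1)) fun Q =>
                costOn G (newClusters G 0.007 R A v.1 s.1 s.2 ∪ Q) (R \ A)) ≤
          2.997 * costOn G P (R \ setC G R v.1) +
            ∑ x ∈ R, ∑ y ∈ R, meanCharge G R A v.1 x y := by
        intro v
        have hs : ∀ s ∈ (sampleLaw G 0.007 0.179 R A v.1).support,
            (expect (modifiedPivotLoop G 0.007 0.179 (R \ setC G R v.1)
              (A ∪ setA G 0.007 R A v.1)) fun Q =>
                costOn G (newClusters G 0.007 R A v.1 s.1 s.2 ∪ Q) (R \ A)) ≤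
            2.997 * costOn G P (R \ setC G R v.1) + ∑ x ∈ R, ∑ y ∈ R,
              charge G A (setC G R v.1) (setA G 0.007 R A v.1) s.1 s.2 x y := by
          intro s hs
          obtain ⟨⟨hD, hDc⟩, hA, hAc⟩ := mem_support_sampleLaw hs
          refine (expect_mono _ fun Q hQ => ?_).trans ((expect_add _ (fun Q => costOn G Q
            ((R \ setC G R v.1) \ (A ∪ setA G 0.007 R A v.1))) fun _ => ∑ x ∈ R, ∑ y ∈ R,
              charge G A (setC G R v.1) (setA G 0.007 R A v.1) s.1 s.2 x y).trans_le ?_)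
          · have hc := costOn_union G (isPartitionOf_newClusters hD hA)
              (isPartitionOf_modifiedPivotLoop 0.007 0.179 _ _ Q hQ) disjoint_clustered_rest
            rw [clustered_union_rest v.2] at hc
            rw [hc]
            exact add_le_add_right (iteration_cost_le v.2 hD hA hDc hAc) _
          · rw [expect_const]
            exact add_le_add_left (ih _ (card_sdiff_setC_lt G R v.1 v.2) _ _ rfl) _
        refine (expect_mono _ hs).trans_eq ?_
        rw [expect_add, expect_const, expect_sum]
        refine congrArg _ (Finset.sum_congr rfl fun x _ => ?_)
        rw [expect_sum]
        rfl
      rw [modifiedPivotLoop_of_nonempty G 0.007 0.179 R A hR, expect_bind]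
      simp only [expect_bind, expect_map]
      refine (expect_mono _ fun v _ => hstep v).trans ?_
      rw [uniformVertex, expect_uniformOfFinset, Finset.card_attach,
        Finset.sum_attach R fun v => 2.997 * costOn G P (R \ setC G R v) +
          ∑ x ∈ R, ∑ y ∈ R, meanCharge G R A v x y,
        div_le_iff₀ (by exact_mod_cast hR.card_pos), Finset.sum_add_distrib, ← Finset.mul_sum]
      have h1 := sum_meanCharge_le (G := G) (R := R) (A := A) hP
      rw [← sum_costOn_sub, Finset.sum_sub_distrib, Finset.sum_const, nsmul_eq_mul] at h1
      linarith
    · rw [modifiedPivotLoop, dif_neg hR, expect_pure, Finset.not_nonempty_iff_eq_empty.mp hR]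
      simp [costOn]

theorem exists_cost_eq_opt (G : SimpleGraph V) [DecidableRel G.Adj]
    (h : ∃ P : Finset (Finset V), IsClustering P) :
    ∃ P : Finset (Finset V), IsClustering P ∧ cost G P = opt G := by
  obtain ⟨P, hP⟩ := h
  exact Nat.sInf_mem (s := {c : ℕ | ∃ P : Finset (Finset V), IsClustering P ∧ cost G P = c})
    ⟨_, P, hP, rfl⟩

end Duality

end CorrelationClustering

theorem theorem2 {V : Type*} [Fintype V] [DecidableEq V] (G : SimpleGraph V)
    [DecidableRel G.Adj] :
    (∀ P ∈ (CorrelationClustering.modifiedPivot G 0.007 0.179).support,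
      CorrelationClustering.IsClustering P) ∧
    CorrelationClustering.expectedCost G (CorrelationClustering.modifiedPivot G 0.007 0.179) ≤
      2.997 * (CorrelationClustering.opt G : ℝ) := by
  open CorrelationClustering in
  have hcl : ∀ P ∈ (modifiedPivot G 0.007 0.179).support, IsClustering P := fun P hP => by
    have h := isPartitionOf_modifiedPivotLoop (G := G) 0.007 0.179 Finset.univ ∅ P hP
    rw [Finset.sdiff_empty] at h
    exact h.isClustering
  refine ⟨hcl, ?_⟩
  -- Any output witnesses that clusterings exist, so the infimum is attained rather than the default
  -- 0 of an empty set.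
  obtain ⟨P₀, hP₀⟩ := (CorrelationClustering.modifiedPivot G 0.007 0.179).support_nonempty
  obtain ⟨P, hP, hcost⟩ := CorrelationClustering.exists_cost_eq_opt G ⟨P₀, hcl P₀ hP₀⟩
  have h := CorrelationClustering.expect_costOn_loop_le (G := G) hP Finset.univ ∅
  rw [Finset.sdiff_empty] at h
  simp only [← CorrelationClustering.two_mul_cost, hcost] at h
  simp only [mul_comm (2 : ℝ)] at h
  rw [CorrelationClustering.expect_mul_const] at h
  change CorrelationClustering.expect (CorrelationClustering.modifiedPivotLoop G 0.007 0.179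
    Finset.univ ∅) (fun Q => (CorrelationClustering.cost G Q : ℝ)) ≤ _
  linarith
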